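/- Let $K$ be a field and let $A=K[x_1,\dots,x_n]/Q$ with $\deg x_i=1$ and $Q$ a homogeneous ideal. For a $\mathbb Z$-graded $A$-module $N$ put $t_i(N)=\sup\{j : \operatorname{Tor}^A_i(N,K)_j\neq 0\}$ (with $\sup\emptyset=-\infty$) and $\operatorname{reg}_A N=\sup\{t_i(N)-i : i\ge 0\}\in\mathbb Z\cup\{\pm\infty\}$, where $K=A/A_+$. The algebra $A$ is called Koszul if $\operatorname{reg}_A K=0$. For $d\ge 1$ let $A^{(d)}=\bigoplus_{i\ge 0}A_{id}$ be the $d$-th Veronese subring, graded by $(A^{(d)})_i=A_{id}$; a graded $A$-module $M$ is regarded as a graded $A^{(d)}$-module whose component of degree $i$ is $\bigoplus_{c=0}^{d-1}M_{id+c}$, and $\operatorname{reg}_{A^{(d)}}$ is defined in the same way over $A^{(d)}$. Let $A$ be Koszul and let $M$ be a finitely generated $\mathbb Z$-graded $A$-module. Then for all $d\ge 1$ $$\operatorname{reg}_{A^{(d)}} M\le\left\lceil\frac{\operatorname{reg}_A M}{d}\right\rceil ,$$ where $\lceil\pm\infty/d\rceil=\pm\infty$. In particular, $\operatorname{reg}_{A^{(d)}}M\le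 1$ whenever $d\ge\operatorname{reg}_A M$. -/

import Mathlib

open scoped TensorProduct DirectSum

set_option linter.unusedSectionVars false

namespace GradedReg

universe u v w

section Graded

variable {K : Type w} {A : Type u} [Field K] [CommRing A] [Algebra K A]

/-- `A` is a quotient `K[x₁, …, xₙ] / Q` of a polynomial ring with `deg xᵢ = 1`, and `𝒜` is the
grading induced from the polynomial ring. (As `𝒜` is required to be a grading of `A` wherever this
is used, the kernel `Q` is then a homogeneous ideal.) -/
def IsStandardGraded (𝒜 : ℕ → Submodule K A) : Prop :=
  ∃ (n : ℕ) (f : MvPolynomial (Fin n) K →ₐ[K] A), Function.Surjective f ∧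
    ∀ k, 𝒜 k = (MvPolynomial.homogeneousSubmodule (Fin n) K k).map f.toLinearMap

/-- The `ℕ`-grading of `A`, extended by zero to negative degrees. -/
def intGrading (𝒜 : ℕ → Submodule K A) : ℤ → Submodule K A
  | Int.ofNat n => 𝒜 n
  | Int.negSucc _ => ⊥

/-- `M = ⨁ₖ ℳ k` is a `ℤ`-graded module over the graded algebra `(A, 𝒜)`. -/
structure IsGradedModule (𝒜 : ℕ → Submodule K A) {M : Type v} [AddCommGroup M] [Module A M]
    (ℳ : ℤ → AddSubgroup M) : Prop where
  isInternal : DirectSum.IsInternal ℳ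
  smul_mem : ∀ (i : ℕ) (k : ℤ) (a : A) (m : M), a ∈ 𝒜 i → m ∈ ℳ k → a • m ∈ ℳ (i + k)

/-- The grading of the free module `⨁_b A(-deg b)`: the basis element `b` has degree `deg b`. -/
def freeGrading (𝒜 : ℕ → Submodule K A) {ι : Type u} (deg : ι → ℤ) (k : ℤ) :
    AddSubgroup (ι →₀ A) where
  carrier := {f | ∀ b, f b ∈ intGrading 𝒜 (k - deg b)}
  zero_mem' := fun b => by simp
  add_mem' := fun {f g} hf hg b => by simpa using add_mem (hf b) (hg b)
  neg_mem' := fun {f} hf b => by simpa using neg_mem (hf b)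

/-- A graded free resolution `⋯ → F₁ → F₀ → N → 0`, where `Fᵢ` is the graded free module on a
basis `ι i` with degrees `deg i`, and all maps are homogeneous of degree `0`. -/
structure GradedFreeResolution (𝒜 : ℕ → Submodule K A) {N : Type u} [AddCommGroup N] [Module A N]
    (𝒩 : ℤ → AddSubgroup N) where
  ι : ℕ → Type u
  deg : ∀ i, ι i → ℤ
  d : ∀ i, (ι (i + 1) →₀ A) →ₗ[A] (ι i →₀ A)
  ε : (ι 0 →₀ A) →ₗ[A] N
  d_mem : ∀ i k, ∀ f ∈ freeGrading 𝒜 (deg (i + 1)) k, d i f ∈ freeGrading 𝒜 (deg i) k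
  ε_mem : ∀ k, ∀ f ∈ freeGrading 𝒜 (deg 0) k, ε f ∈ 𝒩 k
  exact : ∀ i, Function.Exact (d (i + 1)) (d i)
  exact_zero : Function.Exact (d 0) ε
  surjective : Function.Surjective ε

/-! ### Existence of graded free resolutions -/

section Existence

variable (𝒜 : ℕ → Submodule K A) [GradedAlgebra 𝒜]

/-- The component of degree `k : ℤ` of an element of `A`. -/
def intProj : ℤ → A →+ A
  | Int.ofNat n => GradedRing.proj 𝒜 n
  | Int.negSucc _ => 0

theorem intProj_of_mem {j : ℤ} {a : A} (ha : a ∈ intGrading 𝒜 j) (k : ℤ) :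
    intProj 𝒜 k a = if j = k then a else 0 := by
  rcases j with j | j
  · have ha' : a ∈ 𝒜 j := ha
    rcases k with k | k
    · simp only [intProj, GradedRing.proj_apply, DirectSum.decompose_of_mem 𝒜 ha',
        DirectSum.coe_of_apply]
      by_cases h : j = k
      · simp [h]
      · have h2 : ¬ (Int.ofNat j = Int.ofNat k) := fun h3 => h (Int.ofNat.inj h3)
        rw [if_neg h, if_neg h2]; rfl
    · simp [intProj]
  · have ha' : a = 0 := ha
    simp [ha']

theorem mul_mem_intGrading {i : ℕ} {j : ℤ} {a c : A} (ha : a ∈ 𝒜 i) (hc : c ∈ intGrading 𝒜 j) :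
    a * c ∈ intGrading 𝒜 (i + j) := by
  rcases j with j | j
  · have hc' : c ∈ 𝒜 j := hc
    have : a * c ∈ 𝒜 (i + j) := SetLike.mul_mem_graded ha hc'
    exact this
  · have hc' : c = 0 := hc
    simp [hc']

theorem single_mem_freeGrading {ι : Type u} (deg : ι → ℤ) (b : ι) {k : ℤ} {a : A}
    (ha : a ∈ intGrading 𝒜 (k - deg b)) : Finsupp.single b a ∈ freeGrading 𝒜 deg k := by
  intro b'
  by_cases h : b = b'
  · subst h; simpa using ha
  · simp [Finsupp.single_eq_of_ne' h]

theorem freeGrading_isGradedModule {ι : Type u} (deg : ι → ℤ) :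
    IsGradedModule 𝒜 (freeGrading 𝒜 deg) := by
  classical
  refine ⟨⟨?_, ?_⟩, ?_⟩
  · rw [injective_iff_map_eq_zero]
    intro x hx
    ext k b
    have h1 : ∀ y : ⨁ k, freeGrading 𝒜 deg k,
        intProj 𝒜 (k - deg b) ((DirectSum.coeAddMonoidHom (freeGrading 𝒜 deg) y) b) =
          (y k : ι →₀ A) b := by
      intro y
      induction y using DirectSum.induction_on with
      | zero => simp
      | of i y =>
        rw [DirectSum.coeAddMonoidHom_of, intProj_of_mem 𝒜 (y.2 b), DirectSum.coe_of_apply]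
        by_cases h : i = k
        · simp [h]
        · have : ¬ (i - deg b = k - deg b) := by omega
          simp [h]
      | add y z hy hz => simp [hy, hz]
    have := h1 x
    rw [hx] at this
    simpa using this.symm
  · intro f
    change f ∈ AddMonoidHom.mrange (DirectSum.coeAddMonoidHom (freeGrading 𝒜 deg))
    induction f using Finsupp.induction_linear with
    | zero => exact zero_mem _
    | add f g hf hg => exact add_mem hf hg
    | single b a =>
      rw [← DirectSum.sum_support_decompose 𝒜 a, ← Finsupp.singleAddHom_apply, map_sum]
      refine sum_mem fun n _ => ?_
      have hm : Finsupp.single b ((DirectSum.decompose 𝒜 a n : A)) ∈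
          freeGrading 𝒜 deg (n + deg b) := by
        apply single_mem_freeGrading
        rw [add_sub_cancel_right]
        exact (DirectSum.decompose 𝒜 a n).2
      exact ⟨DirectSum.of (fun k => freeGrading 𝒜 deg k) _ ⟨_, hm⟩, by simp⟩
  · intro i k a f ha hf b
    have := mul_mem_intGrading 𝒜 ha (hf b)
    rw [← add_sub_assoc] at this
    simpa using this

/-- A submodule of a graded free module is homogeneous: it is spanned by homogeneous elements. -/
def IsHomogeneous {ι : Type u} (deg : ι → ℤ) (Z : Submodule A (ι →₀ A)) : Prop :=
  Z ≤ Submodule.span A {f | f ∈ Z ∧ ∃ k, f ∈ freeGrading 𝒜 deg k}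

theorem ker_isHomogeneous {ι : Type u} (deg : ι → ℤ) {N : Type u} [AddCommGroup N] [Module A N]
    {𝒩 : ℤ → AddSubgroup N} (h𝒩 : IsGradedModule 𝒜 𝒩) (φ : (ι →₀ A) →ₗ[A] N)
    (hφ : ∀ k, ∀ f ∈ freeGrading 𝒜 deg k, φ f ∈ 𝒩 k) :
    IsHomogeneous 𝒜 deg (LinearMap.ker φ) := by
  classical
  intro f hf
  obtain ⟨x, rfl⟩ := (freeGrading_isGradedModule 𝒜 deg).isInternal.2 f
  let ψ : ∀ k, freeGrading 𝒜 deg k →+ 𝒩 k := fun k =>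
    { toFun := fun g => ⟨φ g, hφ k g g.2⟩
      map_zero' := by ext; simp
      map_add' := fun a b => by ext; simp }
  have h1 : ∀ y : ⨁ k, freeGrading 𝒜 deg k,
      DirectSum.coeAddMonoidHom 𝒩 (DirectSum.map ψ y) =
        φ (DirectSum.coeAddMonoidHom (freeGrading 𝒜 deg) y) := by
    intro y
    induction y using DirectSum.induction_on with
    | zero => simp
    | of i y => simp [ψ]
    | add y z hy hz => simp [hy, hz]
  have h2 : DirectSum.map ψ x = 0 := by
    apply h𝒩.isInternal.1
    rw [h1, map_zero]
    exact hf
  have h3 : ∀ k, φ (x k) = 0 := fun k => by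
    have := congrArg (fun z : ⨁ k, 𝒩 k => ((z k : 𝒩 k) : N)) h2
    simpa [ψ] using this
  rw [DirectSum.coeAddMonoidHom_eq_dfinsuppSum]
  refine Submodule.sum_mem _ fun k _ => Submodule.subset_span ⟨h3 k, k, (x k).2⟩

/-- The graded free module on the homogeneous elements of a set `Z` maps to the ambient module. -/
theorem linearCombination_mem {ι : Type u} (deg : ι → ℤ) {N : Type u} [AddCommGroup N]
    [Module A N] {𝒩 : ℤ → AddSubgroup N} (h𝒩 : IsGradedModule 𝒜 𝒩) (v : ι → N)
    (hv : ∀ b, v b ∈ 𝒩 (deg b)) :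
    ∀ k, ∀ f ∈ freeGrading 𝒜 deg k, Finsupp.linearCombination A v f ∈ 𝒩 k := by
  intro k f hf
  rw [Finsupp.linearCombination_apply]
  refine sum_mem fun b _ => ?_
  have hb := hf b
  rcases h : k - deg b with n | n
  · rw [h] at hb
    have := h𝒩.smul_mem n (deg b) (f b) (v b) hb (hv b)
    have e : (n : ℤ) + deg b = k := by
      have : k - deg b = (n : ℤ) := h
      omega
    rwa [e] at this
  · rw [h] at hb
    have h0 : f b = 0 := hb
    simp [h0]

/-- A graded free module with a homogeneous submodule, one stage of a resolution. -/
structure Stage where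
  ι : Type u
  deg : ι → ℤ
  Z : Submodule A (ι →₀ A)
  hZ : IsHomogeneous 𝒜 deg Z

variable {𝒜}

/-- The homogeneous elements of the submodule, with their degrees. -/
def Stage.Next (s : Stage 𝒜) : Type u :=
  {p : ℤ × (s.ι →₀ A) // p.2 ∈ s.Z ∧ p.2 ∈ freeGrading 𝒜 s.deg p.1}

/-- The graded free module on the homogeneous elements of `Z` covers `Z`. -/
noncomputable def Stage.map (s : Stage 𝒜) : (s.Next →₀ A) →ₗ[A] (s.ι →₀ A) :=
  Finsupp.linearCombination A fun p => p.1.2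

theorem Stage.map_mem (s : Stage 𝒜) :
    ∀ k, ∀ f ∈ freeGrading 𝒜 (fun p : s.Next => p.1.1) k, s.map f ∈ freeGrading 𝒜 s.deg k :=
  linearCombination_mem 𝒜 _ (freeGrading_isGradedModule 𝒜 s.deg) _ fun p => p.2.2

/-- The next stage, given by the kernel of the cover of `Z`. -/
noncomputable def Stage.next (s : Stage 𝒜) : Stage 𝒜 where
  ι := s.Next
  deg := fun p => p.1.1
  Z := LinearMap.ker s.map
  hZ := ker_isHomogeneous 𝒜 _ (freeGrading_isGradedModule 𝒜 s.deg) _ s.map_mem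

theorem Stage.range_map (s : Stage 𝒜) : LinearMap.range s.map = s.Z := by
  rw [Stage.map, Finsupp.range_linearCombination]
  apply le_antisymm
  · rw [Submodule.span_le]
    rintro _ ⟨p, rfl⟩
    exact p.2.1
  · refine s.hZ.trans (Submodule.span_mono ?_)
    rintro f ⟨hf, k, hk⟩
    exact ⟨⟨(k, f), hf, hk⟩, rfl⟩

theorem Stage.exact_of_eq (s : Stage 𝒜) {N : Type u} [AddCommGroup N] [Module A N]
    (φ : (s.ι →₀ A) →ₗ[A] N) (h : s.Z = LinearMap.ker φ) : Function.Exact s.map φ :=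
  LinearMap.exact_iff.mpr (h.symm.trans s.range_map.symm)

theorem Stage.exact_map (s : Stage 𝒜) : Function.Exact s.next.map s.map :=
  s.next.exact_of_eq s.map rfl

theorem GradedFreeResolution.nonempty {N : Type u} [AddCommGroup N] [Module A N]
    {𝒩 : ℤ → AddSubgroup N} (h𝒩 : IsGradedModule 𝒜 𝒩) :
    Nonempty (GradedFreeResolution 𝒜 𝒩) := by
  classical
  let ι₀ : Type u := {p : ℤ × N // p.2 ∈ 𝒩 p.1}
  let ε : (ι₀ →₀ A) →ₗ[A] N := Finsupp.linearCombination A fun p => p.1.2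
  have hε : ∀ k, ∀ f ∈ freeGrading 𝒜 (fun p : ι₀ => p.1.1) k, ε f ∈ 𝒩 k :=
    linearCombination_mem 𝒜 _ h𝒩 _ fun p => p.2
  let s₀ : Stage 𝒜 := ⟨ι₀, fun p => p.1.1, LinearMap.ker ε, ker_isHomogeneous 𝒜 _ h𝒩 ε hε⟩
  let s : ℕ → Stage 𝒜 := fun n => Nat.rec s₀ (fun _ t => t.next) n
  refine ⟨⟨fun i => (s i).ι, fun i => (s i).deg, fun i => (s i).map, ε,
    fun i => (s i).map_mem, hε, fun i => ?_, ?_, ?_⟩⟩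
  · exact Stage.exact_map (s i)
  · exact Stage.exact_of_eq s₀ ε rfl
  · intro x
    obtain ⟨y, rfl⟩ := h𝒩.isInternal.2 x
    rw [DirectSum.coeAddMonoidHom_eq_dfinsuppSum]
    change _ ∈ LinearMap.range ε
    refine Submodule.sum_mem _ fun k _ => ?_
    exact ⟨Finsupp.single ⟨(k, (y k : N)), (y k).2⟩ 1, by simp [ε]⟩

end Existence

/-! ### The residue field, graded Tor, regularity -/

variable (𝒜 : ℕ → Submodule K A) [GradedAlgebra 𝒜]

/-- The `A`-module `A / A₊`, where `A₊ = ⨁_{k > 0} A_k`; if `A₀ = K` this is `K`. -/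
abbrev Residue : Type u := A ⧸ (HomogeneousIdeal.irrelevant 𝒜).toIdeal

/-- The residue field is concentrated in degree `0`. -/
def residueGrading (k : ℤ) : AddSubgroup (Residue 𝒜) := if k = 0 then ⊤ else ⊥

theorem residueGrading_isGradedModule : IsGradedModule 𝒜 (residueGrading 𝒜) := by
  classical
  have h0 : ∀ k : ℤ, k ≠ 0 → ∀ x ∈ residueGrading 𝒜 k, x = 0 := by
    intro k hk x hx
    simpa [residueGrading, hk] using hx
  refine ⟨⟨?_, ?_⟩, ?_⟩
  · rw [injective_iff_map_eq_zero]
    intro x hx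
    have h1 : ∀ y : ⨁ k, residueGrading 𝒜 k,
        DirectSum.coeAddMonoidHom (residueGrading 𝒜) y = (y 0 : Residue 𝒜) := by
      intro y
      induction y using DirectSum.induction_on with
      | zero => simp
      | of i y =>
        rw [DirectSum.coeAddMonoidHom_of, DirectSum.coe_of_apply]
        by_cases h : i = 0
        · simp [h]
        · simp [h, h0 i h y y.2]
      | add y z hy hz => simp [hy, hz]
    ext k
    by_cases hk : k = 0
    · subst hk
      rw [← h1, hx]; rfl
    · rw [h0 k hk _ (x k).2]; rfl
  · intro x
    have hx : x ∈ residueGrading 𝒜 0 := by simp [residueGrading]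
    exact ⟨DirectSum.of (fun k => residueGrading 𝒜 k) 0 ⟨x, hx⟩, by simp⟩
  · intro i k a m ha hm
    by_cases hk : k = 0
    · subst hk
      by_cases hi : i = 0
      · subst hi; simp [residueGrading]
      · obtain ⟨c, rfl⟩ := Ideal.Quotient.mk_surjective m
        have hmem : a * c ∈ (HomogeneousIdeal.irrelevant 𝒜).toIdeal := by
          apply Ideal.mul_mem_right
          change a ∈ HomogeneousIdeal.irrelevant 𝒜
          rw [HomogeneousIdeal.mem_irrelevant_iff, GradedRing.proj_apply,
            DirectSum.decompose_of_mem_ne 𝒜 ha hi]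
        have : a • (Ideal.Quotient.mk (HomogeneousIdeal.irrelevant 𝒜).toIdeal c) = 0 := by
          rw [← Ideal.Quotient.eq_zero_iff_mem] at hmem
          exact hmem
        rw [this]; exact zero_mem _
    · rw [h0 k hk m hm, smul_zero]; exact zero_mem _

/-- A graded free resolution of the residue field `K = A / A₊` over `A`. -/
noncomputable def residueResolution : GradedFreeResolution 𝒜 (residueGrading 𝒜) :=
  Classical.choice (GradedFreeResolution.nonempty (residueGrading_isGradedModule 𝒜))

variable {M : Type v} [AddCommGroup M] [Module A M]

/-- The grading of `M ⊗ F`, for a graded module `M` and a graded free module `F`: the degree `k`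
part is generated by the `m ⊗ f` with `m`, `f` homogeneous and `deg m + deg f = k`. -/
noncomputable def tensorGrading (ℳ : ℤ → AddSubgroup M) {ι : Type u} (deg : ι → ℤ) (k : ℤ) :
    AddSubgroup (M ⊗[A] (ι →₀ A)) :=
  AddSubgroup.closure {t | ∃ (p q : ℤ) (m : M) (f : ι →₀ A), p + q = k ∧ m ∈ ℳ p ∧
    f ∈ freeGrading 𝒜 deg q ∧ t = m ⊗ₜ[A] f}

/-- The `i`-cycles of `M ⊗ F`, where `F` is the graded free resolution of the residue field. -/
noncomputable def torCycles (M : Type v) [AddCommGroup M] [Module A M] :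
    ∀ i : ℕ, Submodule A (M ⊗[A] ((residueResolution 𝒜).ι i →₀ A))
  | 0 => ⊤
  | i + 1 => LinearMap.ker (((residueResolution 𝒜).d i).lTensor M)

/-- The `i`-boundaries of `M ⊗ F`. -/
noncomputable def torBoundaries (M : Type v) [AddCommGroup M] [Module A M] (i : ℕ) :
    Submodule A (M ⊗[A] ((residueResolution 𝒜).ι i →₀ A)) :=
  LinearMap.range (((residueResolution 𝒜).d i).lTensor M)

/-- `Torᵢ(M, K) = Hᵢ(M ⊗ F)`. -/
abbrev ResidueTor (M : Type v) [AddCommGroup M] [Module A M] (i : ℕ) : Type (max u v) :=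
  torCycles 𝒜 M i ⧸ (torBoundaries 𝒜 M i).submoduleOf (torCycles 𝒜 M i)

/-- `Torᵢ(M, K)ⱼ`, the classes of the `i`-cycles of internal degree `j`. -/
noncomputable def residueTorGrading (ℳ : ℤ → AddSubgroup M) (i : ℕ) (j : ℤ) :
    AddSubgroup (ResidueTor 𝒜 M i) :=
  ((tensorGrading 𝒜 ℳ ((residueResolution 𝒜).deg i) j).comap
    (torCycles 𝒜 M i).subtype.toAddMonoidHom).map
    ((torBoundaries 𝒜 M i).submoduleOf (torCycles 𝒜 M i)).mkQ.toAddMonoidHom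

/-- `tᵢ(M) = sup {j | Torᵢ(M, K)ⱼ ≠ 0}` in `ℤ ∪ {-∞, +∞}`, the supremum of `∅` being `-∞`. -/
noncomputable def topDegree (ℳ : ℤ → AddSubgroup M) (i : ℕ) : WithBot (WithTop ℤ) :=
  ⨆ j ∈ {j : ℤ | residueTorGrading 𝒜 ℳ i j ≠ ⊥}, ((j : WithTop ℤ) : WithBot (WithTop ℤ))

/-- The Castelnuovo–Mumford regularity `reg M = sup {tᵢ(M) - i | i ≥ 0}`. -/
noncomputable def reg (ℳ : ℤ → AddSubgroup M) : WithBot (WithTop ℤ) :=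
  ⨆ i : ℕ, topDegree 𝒜 ℳ i + (((-(i : ℤ) : ℤ) : WithTop ℤ) : WithBot (WithTop ℤ))

/-- `A` is Koszul: the residue field has regularity `0`. -/
def IsKoszul : Prop := reg 𝒜 (residueGrading 𝒜) = 0

/-! ### Veronese subrings -/

/-- The Veronese subring `A^(d) = ⨁ᵢ A_{id}`. -/
def veronese (d : ℕ) : Subalgebra K A :=
  (⨆ i : ℕ, 𝒜 (i * d)).toSubalgebra
    (Submodule.mem_iSup_of_mem 0 (by rw [zero_mul]; exact SetLike.one_mem_graded 𝒜))
    (by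
      intro x y hx hy
      induction hx using Submodule.iSup_induction' with
      | zero => simp
      | add a b _ _ ha hb => rw [add_mul]; exact add_mem ha hb
      | mem i a ha =>
        induction hy using Submodule.iSup_induction' with
        | zero => simp
        | add b c _ _ hb hc => rw [mul_add]; exact add_mem hb hc
        | mem j b hb =>
          refine Submodule.mem_iSup_of_mem (i + j) ?_
          rw [add_mul]
          exact SetLike.mul_mem_graded ha hb)

/-- The grading of the Veronese subring: its degree `i` part is `A_{id}`. -/
def veroneseGrading (d : ℕ) (i : ℕ) : Submodule K (veronese 𝒜 d) :=
  (𝒜 (i * d)).comap (veronese 𝒜 d).val.toLinearMap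

instance veroneseGrading_gradedMonoid (d : ℕ) : SetLike.GradedMonoid (veroneseGrading 𝒜 d) where
  one_mem := by
    change (1 : A) ∈ 𝒜 (0 * d)
    rw [zero_mul]; exact SetLike.one_mem_graded 𝒜
  mul_mem := by
    intro i j a b ha hb
    change (a : A) * (b : A) ∈ 𝒜 ((i + j) * d)
    rw [add_mul]
    exact SetLike.mul_mem_graded ha hb

theorem veroneseGrading_isInternal (d : ℕ) [NeZero d] :
    DirectSum.IsInternal (veroneseGrading 𝒜 d) := by
  classical
  refine ⟨?_, ?_⟩
  · rw [injective_iff_map_eq_zero]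
    intro x hx
    have h1 : ∀ (k : ℕ) (y : ⨁ i, veroneseGrading 𝒜 d i),
        GradedRing.proj 𝒜 (k * d)
          ((DirectSum.coeAddMonoidHom (veroneseGrading 𝒜 d) y : veronese 𝒜 d) : A) =
          ((y k : veronese 𝒜 d) : A) := by
      intro k y
      induction y using DirectSum.induction_on with
      | zero => simp
      | of i y =>
        have hy : ((y : veronese 𝒜 d) : A) ∈ 𝒜 (i * d) := y.2
        rw [DirectSum.coeAddMonoidHom_of, DirectSum.coe_of_apply, GradedRing.proj_apply]
        by_cases h : i = k
        · subst h
          rw [DirectSum.decompose_of_mem_same 𝒜 hy]; simp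
        · rw [DirectSum.decompose_of_mem_ne 𝒜 hy
            (fun h2 => h (Nat.eq_of_mul_eq_mul_right (NeZero.pos d) h2))]
          simp [h]
      | add y z hy hz => simp only [map_add, DirectSum.add_apply, Submodule.coe_add,
          Subalgebra.coe_add, hy, hz]
    ext k
    have := h1 k x
    rw [hx] at this
    simpa using this.symm
  · rintro ⟨x, hx⟩
    have hx' : x ∈ ⨆ i : ℕ, 𝒜 (i * d) := hx
    change _ ∈ AddMonoidHom.mrange (DirectSum.coeAddMonoidHom (veroneseGrading 𝒜 d))
    induction hx' using Submodule.iSup_induction' with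
    | zero => exact zero_mem _
    | add a b ha hb iha ihb => exact add_mem (iha ha) (ihb hb)
    | mem i a ha =>
      exact ⟨DirectSum.of (fun k => veroneseGrading 𝒜 d k) i ⟨⟨a, hx⟩, ha⟩, by simp⟩

noncomputable instance veroneseGrading_gradedAlgebra (d : ℕ) [NeZero d] :
    GradedAlgebra (veroneseGrading 𝒜 d) :=
  { veroneseGrading_gradedMonoid 𝒜 d,
    (veroneseGrading_isInternal 𝒜 d).chooseDecomposition with }

/-- `M` as a graded `A^(d)`-module: its degree `i` part is `M_{id} ⊕ M_{id+1} ⊕ ⋯ ⊕ M_{id+d-1}`,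
so `M` is the direct sum of the `⨁ᵢ M_{id+c}` for `0 ≤ c < d`. -/
def veroneseModuleGrading (ℳ : ℤ → AddSubgroup M) (d : ℕ) (i : ℤ) : AddSubgroup M :=
  ⨆ c : Fin d, ℳ (i * d + (c : ℕ))

end Graded

/-- `⌈r / d⌉` for `r ∈ ℤ ∪ {-∞, +∞}`, where `⌈±∞ / d⌉ = ±∞`. -/
noncomputable def ceilDiv (r : WithBot (WithTop ℤ)) (d : ℕ) : WithBot (WithTop ℤ) :=
  WithBot.map (WithTop.map fun z : ℤ => ⌈(z : ℚ) / (d : ℚ)⌉) r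

end GradedReg

/-! Over `A^(d)` the Tor groups of a graded `A`-module `N` keep the finer grading by `A`-degree: in
internal degree `q`, a basis element of degree `k` of the resolution of `K` carries a coefficient
from `N_{q-dk}`. In this grading the claim to prove is `VeroneseBound`: if `N` is bounded below and
`reg_A N ≤ r`, then `Tor_n(N, K)_q = 0` for `q ≥ r + (n+1)d`. The degree `j` of the Veronese grading
collects the `A`-degrees `jd, …, jd+d-1`, and `j > ⌈r/d⌉ + n` gives `jd ≥ r + (n+1)d`; this is the
theorem for finite regularity.

The bound is proved by induction on `n`. For `n = 0`, graded Nakayama generates `N` in degrees at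
most `r`. An element of degree at least `r + d` then has coefficients of degree at least `d`, and
these lie in the ideal generated by `A_d`, because the Koszul property makes `A_1` generate `A_+`.
For the step take `0 → Z → F → N → 0` with `F` graded free on generators of degree at most `r`. Then
`reg Z ≤ r + 1`, while the bound grows by `d ≥ 1`, so the long exact sequence reduces the step to
`F`, hence to `N = A`.

For `A`, write `q = dt + m` with `0 ≤ m < d` and induct on `m`. When `m = 0` only `A^(d)` itself is
seen, which is free. When `m > 0` no degree involved is zero, so `A` may be replaced by `A_+`. This
has regularity at most 1 by the Koszul property; its linear presentation by copies of `A(-1)` leads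
to `m - 1` for the free term and to homological degree one less for the kernel. -/

namespace GradedReg

universe u v w

/-! ### Strands of complexes and long exact sequences for their homology -/

section Framework

variable {K : Type w} {B : Type u} [Field K] [CommRing B] [Algebra K B]

/-! ### Coefficients in a module -/

section Coefficients

variable {ι ι' ι'' : Type*} {N N' : Type*} [AddCommGroup N] [Module B N]
  [AddCommGroup N'] [Module B N']

open scoped Classical in
/-- The map `N ⊗ D` in terms of the identification of `N ⊗ (ι →₀ B)` with `ι →₀ N`. -/
noncomputable def coeffMap (D : (ι →₀ B) →ₗ[B] (ι' →₀ B)) (N : Type*) [AddCommGroup N]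
    [Module B N] : (ι →₀ N) →ₗ[B] (ι' →₀ N) :=
  (TensorProduct.finsuppScalarRight B B N ι').toLinearMap ∘ₗ D.lTensor N ∘ₗ
    (TensorProduct.finsuppScalarRight B B N ι).symm.toLinearMap

open scoped Classical in
theorem coeffMap_finsuppScalarRight (D : (ι →₀ B) →ₗ[B] (ι' →₀ B)) (t : N ⊗[B] (ι →₀ B)) :
    coeffMap D N (TensorProduct.finsuppScalarRight B B N ι t) =
      TensorProduct.finsuppScalarRight B B N ι' (D.lTensor N t) := by
  simp [coeffMap]

theorem coeffMap_single_apply (D : (ι →₀ B) →ₗ[B] (ι' →₀ B)) (b : ι) (m : N) (b' : ι') :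
    coeffMap D N (Finsupp.single b m) b' = D (Finsupp.single b 1) b' • m := by
  simp [coeffMap, TensorProduct.finsuppScalarRight_apply_tmul_apply]

theorem coeffMap_apply (D : (ι →₀ B) →ₗ[B] (ι' →₀ B)) (z : ι →₀ N) (b' : ι') :
    coeffMap D N z b' = z.sum fun b m => D (Finsupp.single b 1) b' • m := by
  conv_lhs => rw [← Finsupp.sum_single z, map_finsuppSum]
  rw [Finsupp.sum_apply]
  simp only [coeffMap_single_apply]

theorem coeffMap_coeffMap (D' : (ι' →₀ B) →ₗ[B] (ι'' →₀ B)) (D : (ι →₀ B) →ₗ[B] (ι' →₀ B))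
    (z : ι →₀ N) : coeffMap D' N (coeffMap D N z) = coeffMap (D' ∘ₗ D) N z := by
  simp [coeffMap, LinearMap.lTensor_comp]

theorem coeffMap_zero (z : ι →₀ N) : coeffMap (0 : (ι →₀ B) →ₗ[B] (ι' →₀ B)) N z = 0 := by
  simp [coeffMap]

theorem coeffMap_self (D : (ι →₀ B) →ₗ[B] (ι' →₀ B)) : coeffMap D B = D := by
  refine Finsupp.lhom_ext' fun b => LinearMap.ext_ring ?_
  ext b'
  simp [coeffMap_single_apply]

theorem mapRange_coeffMap (D : (ι →₀ B) →ₗ[B] (ι' →₀ B)) (ψ : N →ₗ[B] N') (z : ι →₀ N) :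
    Finsupp.mapRange.linearMap ψ (coeffMap D N z) =
      coeffMap D N' (Finsupp.mapRange.linearMap ψ z) := by
  induction z using Finsupp.induction_linear with
  | zero => simp
  | add f g hf hg => simp only [map_add, hf, hg]
  | single b m =>
    ext b'
    simp [coeffMap_single_apply]

theorem mapRange_injective {ψ : N →ₗ[B] N'} (hψ : Function.Injective ψ) :
    Function.Injective (Finsupp.mapRange.linearMap ψ : (ι →₀ N) →ₗ[B] (ι →₀ N')) := by
  intro x y h
  ext b
  apply hψ
  simpa using DFunLike.congr_fun h b

end Coefficients

/-! ### Strands -/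

section Strands

variable {ι ι' : Type*} {N N' : Type*} [AddCommGroup N] [Module B N]
  [AddCommGroup N'] [Module B N']

/-- The functions `z : ι →₀ N` whose coefficient at `b` lies in `𝒢 (deg b)`. -/
def strand (𝒢 : ℤ → AddSubgroup N) (deg : ι → ℤ) : AddSubgroup (ι →₀ N) where
  carrier := {z | ∀ b, z b ∈ 𝒢 (deg b)}
  zero_mem' := fun b => by simp
  add_mem' := fun {f g} hf hg b => by simpa using add_mem (hf b) (hg b)
  neg_mem' := fun {f} hf b => by simpa using neg_mem (hf b)

theorem mapRange_mem_strand {𝒢 : ℤ → AddSubgroup N} {𝒢' : ℤ → AddSubgroup N'} {deg : ι → ℤ}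
    {ψ : N →ₗ[B] N'} (hψ : ∀ k, ∀ x ∈ 𝒢 k, ψ x ∈ 𝒢' k) {z : ι →₀ N} (hz : z ∈ strand 𝒢 deg) :
    Finsupp.mapRange.linearMap ψ z ∈ strand 𝒢' deg := fun b => by
  simpa using hψ _ _ (hz b)

theorem exists_strand_lift {𝒢 : ℤ → AddSubgroup N} {deg : ι → ℤ} {ψ : N →ₗ[B] N'} {z : ι →₀ N'}
    (h : ∀ b, ∃ x ∈ 𝒢 (deg b), ψ x = z b) :
    ∃ y ∈ strand 𝒢 deg, Finsupp.mapRange.linearMap ψ y = z := by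
  classical
  choose x hx hxz using h
  -- The chosen lifts need not vanish where `z` does; taking 0 there keeps the support finite.
  refine ⟨Finsupp.onFinset z.support (fun b => if z b = 0 then 0 else x b) ?_, ?_, ?_⟩
  · intro b hb
    by_contra h0
    simp only [Finsupp.mem_support_iff, not_not] at h0
    simp [h0] at hb
  · intro b
    rw [Finsupp.onFinset_apply]
    split_ifs
    · exact zero_mem _
    · exact hx b
  · ext b
    rw [Finsupp.mapRange.linearMap_apply, Finsupp.mapRange_apply, Finsupp.onFinset_apply]
    split_ifs with h0
    · simp [h0]
    · exact hxz b

variable (ℬ : ℕ → Submodule K B)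

/-- Homogeneous elements of degree `i` lower the index of the family by `i`. -/
def LowersDegree (𝒢 : ℤ → AddSubgroup N) : Prop :=
  ∀ (i : ℕ) (b : B), b ∈ ℬ i → ∀ (k : ℤ), ∀ x ∈ 𝒢 (k + i), b • x ∈ 𝒢 k

variable {ℬ}

theorem LowersDegree.smul_mem {𝒢 : ℤ → AddSubgroup N} (h : LowersDegree ℬ 𝒢) {j k : ℤ} {b : B}
    (hb : b ∈ intGrading ℬ j) {x : N} (hx : x ∈ 𝒢 (k + j)) : b • x ∈ 𝒢 k := by
  rcases j with j | j
  · exact h j b hb k x hx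
  · have : b = 0 := hb
    simp [this]

variable [GradedAlgebra ℬ]

theorem one_mem_intGrading : (1 : B) ∈ intGrading ℬ 0 := SetLike.one_mem_graded ℬ

theorem single_one_mem_freeGrading {ι : Type u} (deg : ι → ℤ) (b : ι) :
    Finsupp.single b (1 : B) ∈ freeGrading ℬ deg (deg b) := by
  apply single_mem_freeGrading
  rw [sub_self]
  exact one_mem_intGrading

/-- The matrix entry of `D` at `b, b'` is homogeneous of degree `deg b - deg' b'`, exactly the shift
from the index `deg b` to the index `deg' b'`. -/
theorem coeffMap_mem_strand {ι ι' : Type u} {deg : ι → ℤ} {deg' : ι' → ℤ}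
    {D : (ι →₀ B) →ₗ[B] (ι' →₀ B)}
    (hD : ∀ k, ∀ f ∈ freeGrading ℬ deg k, D f ∈ freeGrading ℬ deg' k)
    {𝒢 : ℤ → AddSubgroup N} (h𝒢 : LowersDegree ℬ 𝒢) {z : ι →₀ N} (hz : z ∈ strand 𝒢 deg) :
    coeffMap D N z ∈ strand 𝒢 deg' := by
  intro b'
  rw [coeffMap_apply]
  refine sum_mem fun b _ => ?_
  refine h𝒢.smul_mem (hD _ _ (single_one_mem_freeGrading deg b) b') ?_
  have := hz b
  rwa [add_sub_cancel]

/-- A system of projections on the members of the family `𝒩`, with respect to which the homogeneous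
elements of `B` of degree `i` have degree `e * i`. -/
structure GradedProj (ℬ : ℕ → Submodule K B) (e : ℤ) (𝒩 : ℤ → AddSubgroup N) where
  p : ℤ → N →+ N
  mem : ∀ k x, p k x ∈ 𝒩 k
  of_mem : ∀ {j : ℤ} {x : N}, x ∈ 𝒩 j → ∀ k, p k x = if j = k then x else 0
  smul : ∀ (i : ℕ) (b : B), b ∈ ℬ i → ∀ k x, p k (b • x) = b • p (k - e * i) x

namespace GradedProj

variable {𝒩 : ℤ → AddSubgroup N} {e : ℤ}

theorem smul_mem (P : GradedProj ℬ e 𝒩) {i : ℕ} {b : B} (hb : b ∈ ℬ i) {k : ℤ} {x : N}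
    (hx : x ∈ 𝒩 k) : b • x ∈ 𝒩 (k + e * i) := by
  have := P.smul i b hb (k + e * i) x
  rw [add_sub_cancel_right, P.of_mem hx, if_pos rfl] at this
  rw [← this]
  exact P.mem _ _

theorem p_self (P : GradedProj ℬ e 𝒩) {k : ℤ} {x : N} (hx : x ∈ 𝒩 k) : P.p k x = x := by
  rw [P.of_mem hx, if_pos rfl]

theorem smul_int (P : GradedProj ℬ e 𝒩) {j : ℤ} {b : B} (hb : b ∈ intGrading ℬ j) (k : ℤ) (x : N) :
    P.p k (b • x) = b • P.p (k - e * j) x := by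
  rcases j with j | j
  · exact P.smul j b hb k x
  · have : b = 0 := hb
    simp [this]

theorem lowersDegree {𝒢 : ℤ → AddSubgroup N} (P : GradedProj ℬ (-1) 𝒢) : LowersDegree ℬ 𝒢 := by
  intro i b hb k x hx
  have := P.smul_mem hb hx
  have e : k + i + -1 * (i : ℤ) = k := by ring
  rwa [e] at this

/-- Reindexing `k ↦ q - e * k`. -/
def reindex (P : GradedProj ℬ e 𝒩) (he : e ≠ 0) (q : ℤ) :
    GradedProj ℬ (-1) (fun k => 𝒩 (q - e * k)) where
  p k := P.p (q - e * k)
  mem k x := P.mem _ x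
  of_mem {j x} hx k := by
    rw [P.of_mem hx]
    have : (q - e * j = q - e * k) ↔ j = k := by
      rw [sub_right_inj, mul_right_inj' he]
    simp only [this]
  smul i b hb k x := by
    rw [P.smul i b hb]
    congr 2
    ring_nf

/-- Restriction to a submodule. -/
def restrict (P : GradedProj ℬ e 𝒩) (S : Submodule B N) (hS : ∀ k, ∀ x ∈ S, P.p k x ∈ S) :
    GradedProj ℬ e (fun k => (𝒩 k).comap S.subtype.toAddMonoidHom) where
  p k := ((P.p k).comp S.subtype.toAddMonoidHom).codRestrict S fun x => hS k x x.2
  mem k x := P.mem k x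
  of_mem {j x} hx k := by
    have := P.of_mem hx k
    apply Subtype.ext
    refine this.trans ?_
    split_ifs <;> rfl
  smul i b hb k x := by
    ext
    exact P.smul i b hb k x

/-- The projection of `ι →₀ N` on the strand. -/
noncomputable def strandMap (P : GradedProj ℬ (-1) 𝒩) (deg : ι → ℤ) : (ι →₀ N) →+ (ι →₀ N) :=
  Finsupp.liftAddHom fun b => (Finsupp.singleAddHom b).comp (P.p (deg b))

theorem strandMap_apply (P : GradedProj ℬ (-1) 𝒩) (deg : ι → ℤ) (z : ι →₀ N) (b : ι) :
    P.strandMap deg z b = P.p (deg b) (z b) := by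
  classical
  induction z using Finsupp.induction_linear with
  | zero => simp
  | add f g hf hg => simp only [map_add, Finsupp.add_apply, hf, hg]
  | single c m =>
    by_cases h : c = b
    · subst h; simp [strandMap]
    · simp [strandMap, Finsupp.single_eq_of_ne' h]

theorem strandMap_mem (P : GradedProj ℬ (-1) 𝒩) (deg : ι → ℤ) (z : ι →₀ N) :
    P.strandMap deg z ∈ strand 𝒩 deg := fun b => by
  rw [strandMap_apply]; exact P.mem _ _

theorem strandMap_of_mem (P : GradedProj ℬ (-1) 𝒩) {deg : ι → ℤ} {z : ι →₀ N}
    (hz : z ∈ strand 𝒩 deg) : P.strandMap deg z = z := by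
  ext b
  rw [strandMap_apply, P.p_self (hz b)]

theorem strandMap_coeffMap (P : GradedProj ℬ (-1) 𝒩) {ι ι' : Type u} {deg : ι → ℤ}
    {deg' : ι' → ℤ} {D : (ι →₀ B) →ₗ[B] (ι' →₀ B)}
    (hD : ∀ k, ∀ f ∈ freeGrading ℬ deg k, D f ∈ freeGrading ℬ deg' k) (z : ι →₀ N) :
    P.strandMap deg' (coeffMap D N z) = coeffMap D N (P.strandMap deg z) := by
  induction z using Finsupp.induction_linear with
  | zero => simp
  | add f g hf hg => simp only [map_add, hf, hg]
  | single b m =>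
    have h1 : P.strandMap deg (Finsupp.single b m) = Finsupp.single b (P.p (deg b) m) := by
      simp [strandMap]
    ext b'
    rw [h1, strandMap_apply, coeffMap_single_apply, coeffMap_single_apply,
      P.smul_int (hD _ _ (single_one_mem_freeGrading deg b) b')]
    congr 2
    ring_nf

/-- A homogeneous element which is a boundary is the boundary of a homogeneous element. -/
theorem exists_strand_preimage (P : GradedProj ℬ (-1) 𝒩) {ι ι' : Type u} {deg : ι → ℤ}
    {deg' : ι' → ℤ} {D : (ι →₀ B) →ₗ[B] (ι' →₀ B)}
    (hD : ∀ k, ∀ f ∈ freeGrading ℬ deg k, D f ∈ freeGrading ℬ deg' k) {z : ι' →₀ N}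
    (hz : z ∈ strand 𝒩 deg') (h : ∃ w, coeffMap D N w = z) :
    ∃ w ∈ strand 𝒩 deg, coeffMap D N w = z := by
  obtain ⟨w, rfl⟩ := h
  exact ⟨_, P.strandMap_mem deg w, by rw [← P.strandMap_coeffMap hD, P.strandMap_of_mem hz]⟩

end GradedProj

end Strands

/-! ### Vanishing of graded pieces of Tor -/

section Vanishing

variable (ℬ : ℕ → Submodule K B) [GradedAlgebra ℬ]

/-- The differential of the complex `N ⊗ F`, where `F` resolves the residue field. -/
noncomputable abbrev torDiff (N : Type*) [AddCommGroup N] [Module B N] (n : ℕ) :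
    ((residueResolution ℬ).ι (n + 1) →₀ N) →ₗ[B] ((residueResolution ℬ).ι n →₀ N) :=
  coeffMap ((residueResolution ℬ).d n) N

/-- The cycles of `N ⊗ F`. -/
noncomputable def coeffCycles (N : Type*) [AddCommGroup N] [Module B N] :
    ∀ n : ℕ, Submodule B ((residueResolution ℬ).ι n →₀ N)
  | 0 => ⊤
  | n + 1 => LinearMap.ker (torDiff ℬ N n)

/-- The complex `N ⊗ F` restricted to the strands of the family `𝒢` is exact at the place `n`. -/
def TorVanish {N : Type*} [AddCommGroup N] [Module B N] (𝒢 : ℤ → AddSubgroup N) (n : ℕ) : Prop :=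
  ∀ z ∈ strand 𝒢 ((residueResolution ℬ).deg n), z ∈ coeffCycles ℬ N n →
    ∃ w ∈ strand 𝒢 ((residueResolution ℬ).deg (n + 1)), torDiff ℬ N n w = z

variable {ℬ}
variable {N N' N'' : Type*} [AddCommGroup N] [Module B N] [AddCommGroup N'] [Module B N']
  [AddCommGroup N''] [Module B N'']

theorem torDiff_torDiff (n : ℕ) (z : (residueResolution ℬ).ι (n + 2) →₀ N) :
    torDiff ℬ N n (torDiff ℬ N (n + 1) z) = 0 := by
  rw [torDiff, torDiff, coeffMap_coeffMap, ((residueResolution ℬ).exact n).linearMap_comp_eq_zero,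
    coeffMap_zero]

theorem torDiff_mem_coeffCycles (n : ℕ) (z : (residueResolution ℬ).ι (n + 1) →₀ N) :
    torDiff ℬ N n z ∈ coeffCycles ℬ N n := by
  cases n with
  | zero => exact Submodule.mem_top
  | succ n => exact torDiff_torDiff n z

theorem mapRange_mem_coeffCycles (ψ : N →ₗ[B] N') {n : ℕ} {z : (residueResolution ℬ).ι n →₀ N}
    (hz : z ∈ coeffCycles ℬ N n) : Finsupp.mapRange.linearMap ψ z ∈ coeffCycles ℬ N' n := by
  cases n with
  | zero => exact Submodule.mem_top
  | succ n =>
    have hz' : torDiff ℬ N n z = 0 := hz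
    change torDiff ℬ N' n _ = 0
    rw [torDiff, ← mapRange_coeffMap, ← torDiff, hz', map_zero]

theorem mem_coeffCycles_of_mapRange {ψ : N →ₗ[B] N'} (hψ : Function.Injective ψ) {n : ℕ}
    {z : (residueResolution ℬ).ι n →₀ N}
    (hz : Finsupp.mapRange.linearMap ψ z ∈ coeffCycles ℬ N' n) : z ∈ coeffCycles ℬ N n := by
  cases n with
  | zero => exact Submodule.mem_top
  | succ n =>
    have hz' : torDiff ℬ N' n (Finsupp.mapRange.linearMap ψ z) = 0 := hz
    apply mapRange_injective hψ
    rw [map_zero, mapRange_coeffMap]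
    exact hz'

variable {𝒢 : ℤ → AddSubgroup N} {𝒢' : ℤ → AddSubgroup N'} {𝒢'' : ℤ → AddSubgroup N''}

theorem LowersDegree.torDiff_mem (h : LowersDegree ℬ 𝒢) {n : ℕ}
    {z : (residueResolution ℬ).ι (n + 1) →₀ N}
    (hz : z ∈ strand 𝒢 ((residueResolution ℬ).deg (n + 1))) :
    torDiff ℬ N n z ∈ strand 𝒢 ((residueResolution ℬ).deg n) :=
  coeffMap_mem_strand ((residueResolution ℬ).d_mem n) h hz

/-- Strands see only the members of the family, so `φ` need not be onto `N`. This is what allows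
replacing `A` by `A^(d)` or by `A_+` in suitable degrees. -/
theorem TorVanish.of_injective {φ : N' →ₗ[B] N} (hφ : Function.Injective φ)
    (hmem : ∀ k, ∀ x ∈ 𝒢' k, φ x ∈ 𝒢 k) (hsurj : ∀ k, ∀ y ∈ 𝒢 k, ∃ x ∈ 𝒢' k, φ x = y) {n : ℕ}
    (h : TorVanish ℬ 𝒢' n) : TorVanish ℬ 𝒢 n := by
  intro z hz hc
  obtain ⟨y, hy, rfl⟩ := exists_strand_lift fun b => hsurj _ _ (hz b)
  obtain ⟨w, hw, rfl⟩ := h y hy (mem_coeffCycles_of_mapRange hφ hc)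
  exact ⟨_, mapRange_mem_strand hmem hw, (mapRange_coeffMap _ _ _).symm⟩

variable (𝒢 𝒢' 𝒢'') in
/-- Two maps which form short exact sequences of the members of the three families. -/
structure StrandExact (φ : N' →ₗ[B] N) (ψ : N →ₗ[B] N'') : Prop where
  injective : Function.Injective φ
  comp : ∀ x, ψ (φ x) = 0
  map_left : ∀ k, ∀ x ∈ 𝒢' k, φ x ∈ 𝒢 k
  map_right : ∀ k, ∀ x ∈ 𝒢 k, ψ x ∈ 𝒢'' k
  exact : ∀ k, ∀ x ∈ 𝒢 k, ψ x = 0 → ∃ y ∈ 𝒢' k, φ y = x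
  surjective : ∀ k, ∀ y ∈ 𝒢'' k, ∃ x ∈ 𝒢 k, ψ x = y

namespace StrandExact

variable {φ : N' →ₗ[B] N} {ψ : N →ₗ[B] N''}

theorem exists_left (h : StrandExact 𝒢 𝒢' 𝒢'' φ ψ) {ι : Type*} {deg : ι → ℤ} {z : ι →₀ N}
    (hz : z ∈ strand 𝒢 deg) (h0 : Finsupp.mapRange.linearMap ψ z = 0) :
    ∃ y ∈ strand 𝒢' deg, Finsupp.mapRange.linearMap φ y = z :=
  exists_strand_lift fun b => h.exact _ _ (hz b) (by simpa using DFunLike.congr_fun h0 b)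

theorem mapRange_mapRange (h : StrandExact 𝒢 𝒢' 𝒢'' φ ψ) {ι : Type*} (z : ι →₀ N') :
    Finsupp.mapRange.linearMap ψ (Finsupp.mapRange.linearMap φ z) = 0 := by
  ext b
  simp [h.comp]

/-- The piece `Tor_{n+1}(N'') → Tor_n(N') → Tor_n(N)` of the long exact sequence. The resolution is
free, so tensoring with it keeps exactness coefficient by coefficient. -/
theorem torVanish_left (h : StrandExact 𝒢 𝒢' 𝒢'' φ ψ) (h𝒢 : LowersDegree ℬ 𝒢) {n : ℕ}
    (h1 : TorVanish ℬ 𝒢 n) (h2 : TorVanish ℬ 𝒢'' (n + 1)) : TorVanish ℬ 𝒢' n := by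
  intro z hz hc
  obtain ⟨w, hw, hwz⟩ := h1 _ (mapRange_mem_strand h.map_left hz) (mapRange_mem_coeffCycles φ hc)
  have hw0 : Finsupp.mapRange.linearMap ψ w ∈ coeffCycles ℬ N'' (n + 1) := by
    change torDiff ℬ N'' n _ = 0
    rw [torDiff, ← mapRange_coeffMap, ← torDiff, hwz, h.mapRange_mapRange]
  obtain ⟨u, hu, huw⟩ := h2 _ (mapRange_mem_strand h.map_right hw) hw0
  obtain ⟨t, ht, rfl⟩ := exists_strand_lift fun b => h.surjective _ _ (hu b)
  -- Subtracting the boundary of `t` does not change the boundary of `w` and kills its image in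
  -- `N''`, so the difference comes from `N'`.
  have hs : w - torDiff ℬ N (n + 1) t ∈ strand 𝒢 ((residueResolution ℬ).deg (n + 1)) :=
    sub_mem hw (h𝒢.torDiff_mem ht)
  obtain ⟨y, hy, hyw⟩ := h.exists_left hs (by rw [map_sub, mapRange_coeffMap, ← torDiff, huw,
    sub_self])
  refine ⟨y, hy, mapRange_injective h.injective ?_⟩
  rw [mapRange_coeffMap, hyw, ← torDiff, map_sub, torDiff_torDiff, sub_zero, hwz]

/-- The piece `Tor_{n+1}(N) → Tor_{n+1}(N'') → Tor_n(N')`; here `x` is the image of the class of `z`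
under the connecting map. -/
theorem torVanish_right (h : StrandExact 𝒢 𝒢' 𝒢'' φ ψ) (h𝒢 : LowersDegree ℬ 𝒢) {n : ℕ}
    (h1 : TorVanish ℬ 𝒢 (n + 1)) (h2 : TorVanish ℬ 𝒢' n) : TorVanish ℬ 𝒢'' (n + 1) := by
  intro z hz hc
  obtain ⟨y, hy, rfl⟩ := exists_strand_lift fun b => h.surjective _ _ (hz b)
  have hc' : torDiff ℬ N'' n (Finsupp.mapRange.linearMap ψ y) = 0 := hc
  rw [torDiff, ← mapRange_coeffMap] at hc'
  obtain ⟨x, hx, hxy⟩ := h.exists_left (h𝒢.torDiff_mem hy) hc'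
  have hxc : x ∈ coeffCycles ℬ N' n := by
    apply mem_coeffCycles_of_mapRange h.injective
    rw [hxy]
    exact torDiff_mem_coeffCycles n y
  obtain ⟨w, hw, rfl⟩ := h2 x hx hxc
  have hs : y - Finsupp.mapRange.linearMap φ w ∈ strand 𝒢 ((residueResolution ℬ).deg (n + 1)) :=
    sub_mem hy (mapRange_mem_strand h.map_left hw)
  obtain ⟨t, ht, hty⟩ := h1 _ hs (by
    change torDiff ℬ N n _ = 0
    rw [map_sub, torDiff, ← mapRange_coeffMap, hxy, sub_self])
  refine ⟨_, mapRange_mem_strand h.map_right ht, ?_⟩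
  rw [torDiff, ← mapRange_coeffMap, ← torDiff, hty, map_sub, h.mapRange_mapRange, sub_zero]

end StrandExact

end Vanishing

end Framework

/-! ### Projections of graded modules, and Tor in elementary cases -/

section GradedModules

variable {K : Type w} {B : Type u} [Field K] [CommRing B] [Algebra K B]
  {ℬ : ℕ → Submodule K B} [GradedAlgebra ℬ]

/-! ### Projections of graded modules -/

theorem intProj_mul {i : ℕ} {b : B} (hb : b ∈ ℬ i) (k : ℤ) (x : B) :
    intProj ℬ k (b * x) = b * intProj ℬ (k - i) x := by
  classical
  induction x using DirectSum.Decomposition.inductionOn ℬ with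
  | zero => simp
  | add x y hx hy => simp only [mul_add, map_add, hx, hy]
  | @homogeneous j x =>
    have hx : (x : B) ∈ intGrading ℬ (j : ℤ) := x.2
    rw [intProj_of_mem ℬ (mul_mem_intGrading ℬ hb hx), intProj_of_mem ℬ hx]
    have : ((j : ℤ) = k - i) ↔ ((i : ℤ) + j = k) := by omega
    simp only [this, mul_ite, mul_zero]

theorem intProj_mem (k : ℤ) (x : B) : intProj ℬ k x ∈ intGrading ℬ k := by
  rcases k with k | k
  · exact (DirectSum.decompose ℬ x k).2
  · exact zero_mem _

variable (ℬ) in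
/-- The ring `B` as a graded module over itself. -/
def selfGrading (k : ℤ) : AddSubgroup B := (intGrading ℬ k).toAddSubgroup

variable (ℬ) in
/-- The projections of `B` on its graded pieces. -/
def selfProj : GradedProj ℬ 1 (selfGrading ℬ) where
  p := intProj ℬ
  mem := intProj_mem
  of_mem hx k := intProj_of_mem ℬ hx k
  smul i b hb k x := by
    rw [one_mul]
    exact intProj_mul hb k x

/-- The projections of a graded module on its graded pieces. -/
noncomputable def IsGradedModule.gradedProj {N : Type*} [AddCommGroup N] [Module B N]
    {𝒩 : ℤ → AddSubgroup N} (h : IsGradedModule ℬ 𝒩) : GradedProj ℬ 1 𝒩 :=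
  letI := h.isInternal.chooseDecomposition
  have of_mem : ∀ {j : ℤ} {x : N}, x ∈ 𝒩 j → ∀ k,
      ((DirectSum.decompose 𝒩 x k : 𝒩 k) : N) = if j = k then x else 0 := by
    intro j x hx k
    split_ifs with hjk
    · subst hjk
      exact DirectSum.decompose_of_mem_same 𝒩 hx
    · exact DirectSum.decompose_of_mem_ne 𝒩 hx hjk
  { p := fun k =>
      { toFun := fun x => (DirectSum.decompose 𝒩 x k : 𝒩 k)
        map_zero' := by simp
        map_add' := fun x y => by simp [DirectSum.decompose_add] }
    mem := fun k x => (DirectSum.decompose 𝒩 x k).2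
    of_mem := of_mem
    smul := by
      intro i b hb k x
      change ((DirectSum.decompose 𝒩 (b • x) k : 𝒩 k) : N) =
        b • ((DirectSum.decompose 𝒩 x (k - 1 * i) : 𝒩 _) : N)
      induction x using DirectSum.Decomposition.inductionOn 𝒩 with
      | zero => simp
      | add x y hx hy =>
        simp only [smul_add, DirectSum.decompose_add, DirectSum.add_apply, AddSubgroup.coe_add,
          hx, hy]
      | @homogeneous j x =>
        rw [of_mem (h.smul_mem i j b x hb x.2), of_mem x.2]
        have : (j = k - 1 * i) ↔ ((i : ℤ) + j = k) := by omega
        simp only [this, smul_ite, smul_zero] }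

/-! ### Elementary vanishing results -/

/-- With coefficients in `B` the complex is the resolution itself, which is exact; projecting to the
strand makes the preimage homogeneous. -/
theorem torVanish_self_succ (q : ℤ) (n : ℕ) :
    TorVanish ℬ (fun k => selfGrading ℬ (q - 1 * k)) (n + 1) := by
  intro z hz hc
  have hc' : torDiff ℬ B n z = 0 := hc
  rw [torDiff, coeffMap_self] at hc'
  obtain ⟨w, hw⟩ := ((residueResolution ℬ).exact n z).mp hc'
  exact ((selfProj ℬ).reindex one_ne_zero q).exists_strand_preimage
    ((residueResolution ℬ).d_mem (n + 1)) hz ⟨w, by rw [coeffMap_self, hw]⟩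

section Zero

variable {N : Type*} [AddCommGroup N] [Module B N]

-- Right exactness of the tensor product: the cokernel of the first differential is `N ⊗ K`.
open scoped Classical in
theorem exists_torDiff_zero_iff (z : (residueResolution ℬ).ι 0 →₀ N) :
    (∃ w, torDiff ℬ N 0 w = z) ↔
      (residueResolution ℬ).ε.lTensor N
        ((TensorProduct.finsuppScalarRight B B N _).symm z) = 0 := by
  have h := lTensor_exact N (residueResolution ℬ).exact_zero (residueResolution ℬ).surjective
  constructor
  · rintro ⟨w, rfl⟩
    obtain ⟨t, rfl⟩ := (TensorProduct.finsuppScalarRight B B N _).surjective w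
    rw [coeffMap_finsuppScalarRight, LinearEquiv.symm_apply_apply]
    exact (h _).mpr ⟨t, rfl⟩
  · intro hz
    obtain ⟨t, ht⟩ := (h _).mp hz
    refine ⟨TensorProduct.finsuppScalarRight B B N _ t, ?_⟩
    rw [coeffMap_finsuppScalarRight, ht, LinearEquiv.apply_symm_apply]

theorem tmul_residue_eq_zero {x : N}
    (hx : x ∈ (HomogeneousIdeal.irrelevant ℬ).toIdeal • (⊤ : Submodule B N)) (y : Residue ℬ) :
    x ⊗ₜ[B] y = 0 := by
  induction hx using Submodule.smul_induction_on' with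
  | smul a ha m _ =>
    obtain ⟨c, rfl⟩ := Ideal.Quotient.mk_surjective y
    rw [TensorProduct.smul_tmul]
    have : a • (Ideal.Quotient.mk (HomogeneousIdeal.irrelevant ℬ).toIdeal c) =
        Ideal.Quotient.mk (HomogeneousIdeal.irrelevant ℬ).toIdeal (a * c) := rfl
    rw [this, Ideal.Quotient.eq_zero_iff_mem.mpr (Ideal.mul_mem_right _ _ ha),
      TensorProduct.tmul_zero]
  | add x _ y _ hx hy => rw [TensorProduct.add_tmul, hx, hy, add_zero]

theorem mem_smul_top_of_tmul_one {x : N} (hx : x ⊗ₜ[B] (1 : Residue ℬ) = 0) :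
    x ∈ (HomogeneousIdeal.irrelevant ℬ).toIdeal • (⊤ : Submodule B N) := by
  have := congrArg (TensorProduct.tensorQuotEquivQuotSMul N
    (HomogeneousIdeal.irrelevant ℬ).toIdeal) hx
  rw [map_zero] at this
  have h1 : TensorProduct.tensorQuotEquivQuotSMul N (HomogeneousIdeal.irrelevant ℬ).toIdeal
      (x ⊗ₜ[B] (Ideal.Quotient.mk _ 1)) = Submodule.Quotient.mk x := by
    rw [TensorProduct.tensorQuotEquivQuotSMul_tmul_mk, one_smul]
  rw [← Submodule.Quotient.mk_eq_zero, ← h1]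
  exact this

variable {𝒢 : ℤ → AddSubgroup N}

/-- `K` lives in degree 0, so basis elements of nonzero degree die under the augmentation, and only
coefficients from `𝒢 0` have to die in `N ⊗ K = N / B₊N`. -/
theorem torVanish_zero_of_le (P : GradedProj ℬ (-1) 𝒢)
    (h : ∀ x ∈ 𝒢 0, x ∈ (HomogeneousIdeal.irrelevant ℬ).toIdeal • (⊤ : Submodule B N)) :
    TorVanish ℬ 𝒢 0 := by
  intro z hz _
  refine P.exists_strand_preimage ((residueResolution ℬ).d_mem 0) hz ?_
  rw [exists_torDiff_zero_iff, ← Finsupp.sum_single z, map_finsuppSum, map_finsuppSum]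
  refine Finset.sum_eq_zero fun b _ => ?_
  simp only [TensorProduct.finsuppScalarRight_symm_apply_single, LinearMap.lTensor_tmul]
  have hε := (residueResolution ℬ).ε_mem _ _
    (single_one_mem_freeGrading (ℬ := ℬ) ((residueResolution ℬ).deg 0) b)
  by_cases hb : (residueResolution ℬ).deg 0 b = 0
  · apply tmul_residue_eq_zero
    apply h
    rw [← hb]
    exact hz b
  · rw [residueGrading, if_neg hb] at hε
    rw [(AddSubgroup.mem_bot).mp hε, TensorProduct.tmul_zero]

/-- The augmentation kills every component of nonzero degree, so the degree 0 component of any lift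
of 1 is again a lift of 1. -/
theorem exists_freeGrading_zero_eq_one : ∃ f ∈ freeGrading ℬ ((residueResolution ℬ).deg 0) 0,
    (residueResolution ℬ).ε f = 1 := by
  classical
  have hF := freeGrading_isGradedModule ℬ ((residueResolution ℬ).deg 0)
  obtain ⟨f, hf⟩ := (residueResolution ℬ).surjective 1
  have key : ∀ g, (residueResolution ℬ).ε (hF.gradedProj.p 0 g) = (residueResolution ℬ).ε g := by
    intro g
    let := hF.isInternal.chooseDecomposition
    induction g using DirectSum.Decomposition.inductionOn
      (freeGrading ℬ ((residueResolution ℬ).deg 0)) with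
    | zero => simp
    | add x y hx hy => simp only [map_add, hx, hy]
    | @homogeneous j x =>
      rw [hF.gradedProj.of_mem x.2]
      split_ifs with hj
      · rfl
      · have := (residueResolution ℬ).ε_mem _ _ x.2
        rw [residueGrading, if_neg hj] at this
        rw [(AddSubgroup.mem_bot).mp this, map_zero]
  exact ⟨_, hF.gradedProj.mem 0 f, (key f).trans hf⟩

/-- Converse to `torVanish_zero_of_le`: with `f` a lift of 1 of degree 0, the element `x ⊗ f` lies
in the strand and maps to `x ⊗ 1` in `N ⊗ K`. -/
theorem TorVanish.mem_irrelevant_smul (hG : LowersDegree ℬ 𝒢) (h : TorVanish ℬ 𝒢 0) {x : N}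
    (hx : x ∈ 𝒢 0) : x ∈ (HomogeneousIdeal.irrelevant ℬ).toIdeal • (⊤ : Submodule B N) := by
  classical
  obtain ⟨f, hf, hf1⟩ := exists_freeGrading_zero_eq_one (ℬ := ℬ)
  have hz : TensorProduct.finsuppScalarRight B B N _ (x ⊗ₜ[B] f) ∈
      strand 𝒢 ((residueResolution ℬ).deg 0) := by
    intro b
    rw [TensorProduct.finsuppScalarRight_apply_tmul_apply]
    refine hG.smul_mem (hf b) ?_
    rwa [zero_sub, add_neg_cancel]
  obtain ⟨w, -, hw⟩ := h _ hz Submodule.mem_top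
  have := (exists_torDiff_zero_iff _).mp ⟨w, hw⟩
  rw [LinearEquiv.symm_apply_apply, LinearMap.lTensor_tmul, hf1] at this
  exact mem_smul_top_of_tmul_one this

end Zero

/-! ### Direct sums -/

/-- Tor commutes with direct sums. The family may vary with the summand, to accommodate the degree
shifts of the generators. -/
theorem TorVanish.of_decomposition {N N₀ : Type*} [AddCommGroup N] [Module B N] [AddCommGroup N₀]
    [Module B N₀] {β : Type*} (i : β → N₀ →ₗ[B] N) (π : β → N →ₗ[B] N₀)
    (hfin : ∀ x, {b | π b x ≠ 0}.Finite)
    (hsum : ∀ (S : Finset β) (x : N), (∀ b, π b x ≠ 0 → b ∈ S) → ∑ b ∈ S, i b (π b x) = x)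
    {𝒢 : ℤ → AddSubgroup N} {𝒢₀ : β → ℤ → AddSubgroup N₀}
    (hi : ∀ b k, ∀ x ∈ 𝒢₀ b k, i b x ∈ 𝒢 k) (hπ : ∀ b k, ∀ x ∈ 𝒢 k, π b x ∈ 𝒢₀ b k) {n : ℕ}
    (h : ∀ b, TorVanish ℬ (𝒢₀ b) n) : TorVanish ℬ 𝒢 n := by
  classical
  intro z hz hc
  choose w hw hwz using fun b => h b _ (mapRange_mem_strand (hπ b) hz)
    (mapRange_mem_coeffCycles (π b) hc)
  let S : Finset β := z.support.biUnion fun c => (hfin (z c)).toFinset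
  refine ⟨∑ b ∈ S, Finsupp.mapRange.linearMap (i b) (w b),
    sum_mem fun b _ => mapRange_mem_strand (hi b) (hw b), ?_⟩
  rw [map_sum]
  have h1 : ∀ b, torDiff ℬ N n (Finsupp.mapRange.linearMap (i b) (w b)) =
      Finsupp.mapRange.linearMap (i b) (Finsupp.mapRange.linearMap (π b) z) := fun b => by
    rw [torDiff, ← mapRange_coeffMap, ← torDiff, hwz]
  simp only [h1]
  ext c
  simp only [Finsupp.finsetSum_apply, Finsupp.mapRange.linearMap_apply, Finsupp.mapRange_apply]
  by_cases hzc : z c = 0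
  · simp [hzc]
  · refine hsum S (z c) fun b hb => ?_
    exact Finset.mem_biUnion.mpr ⟨c, by simpa using hzc, by simpa using hb⟩

end GradedModules

/-! ### Graded Nakayama and free presentations of modules bounded below -/

section Presentations

variable {K : Type w} {B : Type u} [Field K] [CommRing B] [Algebra K B]
  {ℬ : ℕ → Submodule K B} [GradedAlgebra ℬ]

/-! ### Free presentations of bounded below graded modules -/

theorem mem_irrelevant_of_mem_selfGrading {q : ℤ} (hq : 0 < q) {x : B}
    (hx : x ∈ selfGrading ℬ q) : x ∈ (HomogeneousIdeal.irrelevant ℬ).toIdeal := by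
  change x ∈ HomogeneousIdeal.irrelevant ℬ
  rw [HomogeneousIdeal.mem_irrelevant_iff]
  have := intProj_of_mem ℬ hx 0
  rwa [if_neg hq.ne'] at this

theorem torVanish_self_zero {q : ℤ} (hq : 0 < q) :
    TorVanish ℬ (fun k => selfGrading ℬ (q - 1 * k)) 0 := by
  refine torVanish_zero_of_le ((selfProj ℬ).reindex one_ne_zero q) fun x hx => ?_
  rw [mul_zero, sub_zero] at hx
  rw [smul_eq_mul, Ideal.mul_top]
  exact mem_irrelevant_of_mem_selfGrading hq hx

theorem selfGrading_eq_zero {k : ℤ} (hk : k < 0) {x : B} (hx : x ∈ selfGrading ℬ k) : x = 0 := by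
  rcases k with k | k
  · simp at hk; omega
  · exact hx

variable {N : Type v} [AddCommGroup N] [Module B N] {𝒩 : ℤ → AddSubgroup N}

variable (ℬ) in
/-- `Torₙ(N, K)` vanishes in degrees larger than `r + n`. -/
def RegularityLE (𝒩 : ℤ → AddSubgroup N) (r : ℤ) : Prop :=
  ∀ (n : ℕ) (q : ℤ), r + n < q → TorVanish ℬ (fun k => 𝒩 (q - 1 * k)) n

namespace GradedProj

theorem p_smul_of_mem (P : GradedProj ℬ 1 𝒩) {j : ℤ} {v : N} (hv : v ∈ 𝒩 j) (k : ℤ) (a : B) :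
    P.p k (a • v) = intProj ℬ (k - 1 * j) a • v := by
  classical
  induction a using DirectSum.Decomposition.inductionOn ℬ with
  | zero => simp
  | add x y hx hy => simp only [add_smul, map_add, hx, hy]
  | @homogeneous i x =>
    have hx : (x : B) ∈ intGrading ℬ (i : ℤ) := x.2
    rw [P.smul i x x.2, P.of_mem hv, intProj_of_mem ℬ hx]
    have : (j = k - 1 * (i : ℤ)) ↔ ((i : ℤ) = k - 1 * j) := by omega
    simp only [this, smul_ite, smul_zero, ite_smul, zero_smul]

theorem p_mem_of_mem_irrelevant_smul (P : GradedProj ℬ 1 𝒩) {x : N}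
    (hx : x ∈ (HomogeneousIdeal.irrelevant ℬ).toIdeal • (⊤ : Submodule B N)) {q : ℤ}
    {G : Submodule B N} (hG : ∀ j < q, ∀ y ∈ 𝒩 j, y ∈ G) : P.p q x ∈ G := by
  classical
  induction hx using Submodule.smul_induction_on' with
  | smul a ha m _ =>
    rw [← DirectSum.sum_support_decompose ℬ a, Finset.sum_smul, map_sum]
    refine sum_mem fun i _ => ?_
    rw [P.smul i _ (DirectSum.decompose ℬ a i).2]
    rcases Nat.eq_zero_or_pos i with rfl | hi
    · have : GradedRing.proj ℬ 0 a = 0 := (HomogeneousIdeal.mem_irrelevant_iff ℬ a).mp ha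
      rw [GradedRing.proj_apply] at this
      rw [this, zero_smul]
      exact zero_mem _
    · exact G.smul_mem _ (hG _ (by omega) _ (P.mem _ _))
  | add x _ y _ hx hy => rw [map_add]; exact add_mem hx hy

/-- A graded version of Nakayama's lemma. -/
theorem mem_span_of_regularityLE (P : GradedProj ℬ 1 𝒩) {s r : ℤ}
    (hs : ∀ k < s, ∀ x ∈ 𝒩 k, x = 0)
    (hr : ∀ q, r < q → TorVanish ℬ (fun k => 𝒩 (q - 1 * k)) 0) (q : ℤ) (x : N) (hx : x ∈ 𝒩 q) :
    x ∈ Submodule.span B {y | ∃ k, s ≤ k ∧ k ≤ r ∧ y ∈ 𝒩 k} := by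
  -- Induction on the distance above `s`, below which the module vanishes.
  have key : ∀ (n : ℕ) (q : ℤ), q < s + n → ∀ x ∈ 𝒩 q,
      x ∈ Submodule.span B {y | ∃ k, s ≤ k ∧ k ≤ r ∧ y ∈ 𝒩 k} := by
    intro n
    induction n with
    | zero =>
      intro q hq x hx
      rw [hs q (by simpa using hq) x hx]
      exact zero_mem _
    | succ n ih =>
      intro q hq x hx
      by_cases hsq : q < s
      · rw [hs q hsq x hx]
        exact zero_mem _
      by_cases hqr : q ≤ r
      · exact Submodule.subset_span ⟨q, by omega, hqr, hx⟩
      -- Above degree `r`, vanishing of Tor₀ puts `x` in `B₊N`; the component of degree `q` then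
      -- involves only elements of smaller degree.
      have h1 := (hr q (by omega)).mem_irrelevant_smul
        (P.reindex one_ne_zero q).lowersDegree (x := x) (by simpa using hx)
      have h2 := P.p_mem_of_mem_irrelevant_smul h1 (q := q) fun j hj y hy =>
        ih j (by push_cast at hq; omega) y hy
      rwa [P.p_self hx] at h2
  exact key (q - s + 1).toNat q (by omega) x hx

end GradedProj

theorem StrandExact.reindex {N' N'' : Type*} [AddCommGroup N'] [Module B N'] [AddCommGroup N'']
    [Module B N''] {𝒩' : ℤ → AddSubgroup N'} {𝒩'' : ℤ → AddSubgroup N''} {φ : N' →ₗ[B] N}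
    {ψ : N →ₗ[B] N''} (h : StrandExact 𝒩 𝒩' 𝒩'' φ ψ) (σ : ℤ → ℤ) :
    StrandExact (fun k => 𝒩 (σ k)) (fun k => 𝒩' (σ k)) (fun k => 𝒩'' (σ k)) φ ψ where
  injective := h.injective
  comp := h.comp
  map_left _ := h.map_left _
  map_right _ := h.map_right _
  exact _ := h.exact _
  surjective _ := h.surjective _

variable (ℬ) in
/-- A presentation `0 → Z → F → N → 0` of a graded module, where `F` is graded free on a basis with
degrees between `s` and `r`; the freeness is expressed by the inclusions and the projections of the
summands `B` of `F`. -/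
structure FreePresentation (𝒩 : ℤ → AddSubgroup N) (s r : ℤ) where
  F : Type (max u v)
  Z : Type (max u v)
  [addCommGroupF : AddCommGroup F]
  [moduleF : Module B F]
  [addCommGroupZ : AddCommGroup Z]
  [moduleZ : Module B Z]
  gr : ℤ → AddSubgroup F
  grZ : ℤ → AddSubgroup Z
  proj : GradedProj ℬ 1 gr
  projZ : GradedProj ℬ 1 grZ
  β : Type v
  deg : β → ℤ
  le_deg : ∀ b, s ≤ deg b
  deg_le : ∀ b, deg b ≤ r
  i : β → B →ₗ[B] F
  π : β → F →ₗ[B] B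
  finite : ∀ x, {b | π b x ≠ 0}.Finite
  sum_eq : ∀ (S : Finset β) (x : F), (∀ b, π b x ≠ 0 → b ∈ S) → ∑ b ∈ S, i b (π b x) = x
  i_mem : ∀ b k, ∀ x ∈ selfGrading ℬ (k - deg b), i b x ∈ gr k
  π_mem : ∀ b k, ∀ x ∈ gr k, π b x ∈ selfGrading ℬ (k - deg b)
  φ : Z →ₗ[B] F
  ψ : F →ₗ[B] N
  exact : StrandExact gr grZ 𝒩 φ ψ

attribute [instance] FreePresentation.addCommGroupF FreePresentation.moduleF
  FreePresentation.addCommGroupZ FreePresentation.moduleZ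

/-- The grading of the free module on `β`, with basis elements of degrees `deg`. -/
def finsuppGrading {β : Type v} (deg : β → ℤ) (k : ℤ) : AddSubgroup (β →₀ B) :=
  strand (fun j => selfGrading ℬ (k - 1 * j)) deg

/-- The projections of a graded free module. -/
noncomputable def finsuppProj {β : Type v} (deg : β → ℤ) :
    GradedProj ℬ 1 (finsuppGrading (ℬ := ℬ) deg) where
  p k := ((selfProj ℬ).reindex one_ne_zero k).strandMap deg
  mem k x := GradedProj.strandMap_mem _ deg x
  of_mem {j x} hx k := by
    ext b
    rw [GradedProj.strandMap_apply]
    have h1 := (selfProj ℬ).of_mem (hx b) (k - 1 * deg b)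
    refine h1.trans ?_
    have : (j - 1 * deg b = k - 1 * deg b) ↔ j = k := by omega
    simp only [this]
    split_ifs <;> rfl
  smul i b hb k x := by
    ext c
    rw [Finsupp.smul_apply, GradedProj.strandMap_apply, GradedProj.strandMap_apply,
      Finsupp.smul_apply]
    refine ((selfProj ℬ).smul i b hb _ _).trans ?_
    change _ = b • (selfProj ℬ).p (k - 1 * (i : ℤ) - 1 * deg c) (x c)
    congr 3
    ring

theorem linearCombination_finsuppProj (P : GradedProj ℬ 1 𝒩) {β : Type v} {deg : β → ℤ} {v : β → N}
    (hv : ∀ b, v b ∈ 𝒩 (deg b)) (k : ℤ) (f : β →₀ B) :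
    Finsupp.linearCombination B v ((finsuppProj (ℬ := ℬ) deg).p k f) =
      P.p k (Finsupp.linearCombination B v f) := by
  induction f using Finsupp.induction_linear with
  | zero => simp
  | add f g hf hg => simp only [map_add, hf, hg]
  | single b a =>
    rw [Finsupp.linearCombination_single, P.p_smul_of_mem (hv b)]
    have : (finsuppProj (ℬ := ℬ) deg).p k (Finsupp.single b a) =
        Finsupp.single b (intProj ℬ (k - 1 * deg b) a) := by
      simp [finsuppProj, GradedProj.strandMap, GradedProj.reindex, selfProj]
    rw [this, Finsupp.linearCombination_single]

/-- All homogeneous elements with degree between `s` and `r` serve as generators, and graded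
Nakayama makes them generate. Finiteness of the generating set plays no role. -/
theorem FreePresentation.nonempty (P : GradedProj ℬ 1 𝒩) {s r : ℤ}
    (hs : ∀ k < s, ∀ x ∈ 𝒩 k, x = 0)
    (hr : ∀ q, r < q → TorVanish ℬ (fun k => 𝒩 (q - 1 * k)) 0) :
    Nonempty (FreePresentation ℬ 𝒩 s r) := by
  classical
  let β : Type v := {p : ℤ × N // s ≤ p.1 ∧ p.1 ≤ r ∧ p.2 ∈ 𝒩 p.1}
  let deg : β → ℤ := fun b => b.1.1
  have hv : ∀ b : β, b.1.2 ∈ 𝒩 (deg b) := fun b => b.2.2.2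
  let Q := finsuppProj (ℬ := ℬ) deg
  let ψ : (β →₀ B) →ₗ[B] N := Finsupp.linearCombination B fun b => b.1.2
  have hψ : ∀ k f, ψ (Q.p k f) = P.p k (ψ f) := linearCombination_finsuppProj P hv
  refine ⟨{
    F := β →₀ B
    Z := LinearMap.ker ψ
    gr := finsuppGrading (ℬ := ℬ) deg
    grZ := _
    proj := Q
    projZ := Q.restrict (LinearMap.ker ψ) fun k x hx => by
      rw [LinearMap.mem_ker] at hx ⊢
      rw [hψ, hx, map_zero]
    β := β
    deg := deg
    le_deg := fun b => b.2.1
    deg_le := fun b => b.2.2.1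
    i := Finsupp.lsingle
    π := Finsupp.lapply
    finite := fun x => x.hasFiniteSupport
    sum_eq := ?_
    i_mem := ?_
    π_mem := fun b k x hx => by
      have h : x b ∈ selfGrading ℬ (k - 1 * deg b) := hx b
      rwa [one_mul] at h
    φ := (LinearMap.ker ψ).subtype
    ψ := ψ
    exact := ⟨Subtype.val_injective, fun x => x.2, fun k x hx => hx, ?_, ?_, ?_⟩ }⟩
  · intro S x hx
    refine Eq.trans ?_ (Finsupp.sum_single x)
    rw [Finsupp.sum_of_support_subset x (s := S) (fun b hb => hx b (by simpa using hb)) _ (by simp)]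
    rfl
  · intro b k x hx c
    by_cases h : b = c
    · subst h
      simpa using hx
    · rw [Finsupp.lsingle_apply, Finsupp.single_eq_of_ne' h]
      exact zero_mem _
  · intro k x hx
    rw [← Q.p_self hx, hψ]
    exact P.mem _ _
  · intro k x hx h0
    exact ⟨⟨x, h0⟩, hx, rfl⟩
  · intro k y hy
    have h1 := P.mem_span_of_regularityLE hs hr k y hy
    have h2 : {y | ∃ k, s ≤ k ∧ k ≤ r ∧ y ∈ 𝒩 k} = Set.range fun b : β => b.1.2 := by
      ext y
      constructor
      · rintro ⟨k, h1, h2, h3⟩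
        exact ⟨⟨(k, y), h1, h2, h3⟩, rfl⟩
      · rintro ⟨b, rfl⟩
        exact ⟨deg b, b.2⟩
    rw [h2, ← Finsupp.range_linearCombination] at h1
    obtain ⟨f, hf⟩ := h1
    exact ⟨Q.p k f, Q.mem k f, by rw [hψ, show ψ f = y from hf, P.p_self hy]⟩

namespace FreePresentation

variable {s r : ℤ} (X : FreePresentation ℬ 𝒩 s r)

theorem grZ_eq_zero {k : ℤ} (hk : k < s) {x : X.Z} (hx : x ∈ X.grZ k) : x = 0 := by
  apply X.exact.injective
  rw [map_zero, ← X.sum_eq (X.finite (X.φ x)).toFinset (X.φ x) fun b hb => by simpa using hb]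
  refine Finset.sum_eq_zero fun b _ => ?_
  rw [selfGrading_eq_zero _ (X.π_mem b k _ (X.exact.map_left k x hx)), map_zero]
  have := X.le_deg b
  omega

/-- Each summand `B(-deg b)` has Tor only in homological degree 0 and internal degree `deg b ≤ r`.
-/
theorem regularityLE_gr : RegularityLE ℬ X.gr r := by
  intro n q hq
  refine TorVanish.of_decomposition X.i X.π X.finite X.sum_eq
    (𝒢₀ := fun b k => selfGrading ℬ (q - X.deg b - 1 * k)) ?_ ?_ fun b => ?_
  · intro b k x hx
    exact X.i_mem b _ x (by convert hx using 2; ring)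
  · intro b k x hx
    convert X.π_mem b _ x hx using 2
    ring
  · cases n with
    | zero =>
      have := X.deg_le b
      exact torVanish_self_zero (by push_cast at hq; omega)
    | succ n => exact torVanish_self_succ _ n

/-- `Tor_n(Z)` lies between `Tor_{n+1}(N)` and `Tor_n(F)`, so passing to the kernel costs one in
regularity. -/
theorem regularityLE_grZ (h : RegularityLE ℬ 𝒩 r) : RegularityLE ℬ X.grZ (r + 1) := by
  intro n q hq
  exact (X.exact.reindex fun k => q - 1 * k).torVanish_left
    (X.proj.reindex one_ne_zero q).lowersDegree (X.regularityLE_gr n q (by omega))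
    (h (n + 1) q (by push_cast; omega))

end FreePresentation

end Presentations

/-! ### Vanishing of Tor over the Veronese subring -/

section Veronese

variable {K : Type w} {A : Type u} [Field K] [CommRing A] [Algebra K A]
  {𝒜 : ℕ → Submodule K A} [GradedAlgebra 𝒜] {d : ℕ} [NeZero d]

/-! ### Restriction of scalars to the Veronese subring -/

theorem mem_veronese {i : ℕ} {a : A} (ha : a ∈ 𝒜 (i * d)) : a ∈ veronese 𝒜 d :=
  Submodule.mem_iSup_of_mem i ha

theorem coe_mem_selfGrading {j : ℤ} {x : veronese 𝒜 d}
    (hx : x ∈ selfGrading (veroneseGrading 𝒜 d) j) : (x : A) ∈ selfGrading 𝒜 (d * j) := by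
  rcases j with j | j
  · have hx' : (x : A) ∈ 𝒜 (j * d) := hx
    have : (d : ℤ) * Int.ofNat j = Int.ofNat (j * d) := by simp [mul_comm]
    rw [this]
    exact hx'
  · have hx' : x = 0 := hx
    rw [hx']
    exact zero_mem _

theorem exists_coe_eq_of_mem_selfGrading {j : ℤ} {y : A} (hy : y ∈ selfGrading 𝒜 (d * j)) :
    ∃ x ∈ selfGrading (veroneseGrading 𝒜 d) j, (x : A) = y := by
  have hd : 0 < d := NeZero.pos d
  rcases j with j | j
  · have : (d : ℤ) * Int.ofNat j = Int.ofNat (j * d) := by simp [mul_comm]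
    rw [this] at hy
    exact ⟨⟨y, mem_veronese hy⟩, hy, rfl⟩
  · refine ⟨0, zero_mem _, ?_⟩
    rw [selfGrading_eq_zero _ hy, ZeroMemClass.coe_zero]
    exact mul_neg_of_pos_of_neg (by exact_mod_cast hd) (Int.negSucc_lt_zero j)

variable (d) in
/-- The projections of a graded `A`-module, over the Veronese subring. -/
def GradedProj.veronese {N : Type*} [AddCommGroup N] [Module A N] {𝒩 : ℤ → AddSubgroup N}
    (P : GradedProj 𝒜 1 𝒩) : GradedProj (veroneseGrading 𝒜 d) (d : ℤ) 𝒩 where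
  p := P.p
  mem := P.mem
  of_mem := P.of_mem
  smul i b hb k x := by
    have := P.smul (i * d) (b : A) hb k x
    rw [Subalgebra.smul_def, Subalgebra.smul_def, this]
    congr 3
    push_cast
    ring

variable (𝒜 d) in
/-- The restriction of scalars of a linear map to the Veronese subring. -/
def veroneseMap {N N' : Type*} [AddCommGroup N] [Module A N] [AddCommGroup N'] [Module A N']
    (φ : N →ₗ[A] N') : N →ₗ[veronese 𝒜 d] N' where
  toFun := φ
  map_add' := map_add φ
  map_smul' b x := by
    rw [Subalgebra.smul_def, map_smul]
    rfl

variable (𝒜 d) in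
theorem StrandExact.veronese {N N' N'' : Type*} [AddCommGroup N] [Module A N] [AddCommGroup N']
    [Module A N'] [AddCommGroup N''] [Module A N''] {𝒢 : ℤ → AddSubgroup N}
    {𝒢' : ℤ → AddSubgroup N'} {𝒢'' : ℤ → AddSubgroup N''} {φ : N' →ₗ[A] N} {ψ : N →ₗ[A] N''}
    (h : StrandExact 𝒢 𝒢' 𝒢'' φ ψ) :
    StrandExact 𝒢 𝒢' 𝒢'' (veroneseMap 𝒜 d φ) (veroneseMap 𝒜 d ψ) where
  injective := h.injective
  comp := h.comp
  map_left := h.map_left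
  map_right := h.map_right
  exact := h.exact
  surjective := h.surjective

variable (𝒜 d) in
/-- The vanishing of the part of internal degree `q` of `Torₙ(N, K)` over the Veronese subring,
where the internal degree is the one of the `A`-module `N`. -/
def VeroneseTorVanish {N : Type*} [AddCommGroup N] [Module A N] (𝒩 : ℤ → AddSubgroup N) (n : ℕ)
    (q : ℤ) : Prop :=
  TorVanish (veroneseGrading 𝒜 d) (fun k => 𝒩 (q - d * k)) n

theorem FreePresentation.veroneseTorVanish_gr {N : Type v} [AddCommGroup N] [Module A N]
    {𝒩 : ℤ → AddSubgroup N} {s r : ℤ} (X : FreePresentation 𝒜 𝒩 s r) {n : ℕ} {q : ℤ}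
    (h : ∀ j, s ≤ j → j ≤ r → VeroneseTorVanish 𝒜 d (selfGrading 𝒜) n (q - j)) :
    VeroneseTorVanish 𝒜 d X.gr n q := by
  refine TorVanish.of_decomposition (fun b => veroneseMap 𝒜 d (X.i b))
    (fun b => veroneseMap 𝒜 d (X.π b)) X.finite X.sum_eq
    (𝒢₀ := fun b k => selfGrading 𝒜 (q - X.deg b - d * k)) ?_ ?_ fun b =>
      h (X.deg b) (X.le_deg b) (X.deg_le b)
  · intro b k x hx
    exact X.i_mem b _ x (by convert hx using 2; ring)
  · intro b k x hx
    have := X.π_mem b _ x hx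
    rwa [sub_right_comm] at this

/-- `F` is free over `A` but in general not over `A^(d)`, so its higher Tor is controlled by that of
`A`, shifted by the generator degrees. -/
theorem FreePresentation.veroneseTorVanish_succ {N : Type v} [AddCommGroup N] [Module A N]
    {𝒩 : ℤ → AddSubgroup N} {s r : ℤ} (X : FreePresentation 𝒜 𝒩 s r) {n : ℕ} {q : ℤ}
    (h1 : ∀ j, s ≤ j → j ≤ r → VeroneseTorVanish 𝒜 d (selfGrading 𝒜) (n + 1) (q - j))
    (h2 : VeroneseTorVanish 𝒜 d X.grZ n q) : VeroneseTorVanish 𝒜 d 𝒩 (n + 1) q :=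
  ((X.exact.veronese 𝒜 d).reindex fun k => q - d * k).torVanish_right
    ((X.proj.veronese d).reindex (by exact_mod_cast NeZero.ne d) q).lowersDegree
    (X.veroneseTorVanish_gr h1) h2

/-! ### Vanishing of Tor over the Veronese subring -/

theorem mem_span_selfGrading
    (hA : ∀ q, 0 < q → ∀ x ∈ selfGrading 𝒜 q, x ∈ Ideal.span (selfGrading 𝒜 1 : Set A)) (e : ℕ) :
    ∀ q, (e : ℤ) ≤ q → ∀ x ∈ selfGrading 𝒜 q, x ∈ Ideal.span (selfGrading 𝒜 e : Set A) := by
  induction e with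
  | zero =>
    intro q _ x _
    have h1 : (1 : A) ∈ (selfGrading 𝒜 (0 : ℕ) : Set A) := one_mem_intGrading (ℬ := 𝒜)
    rw [(Ideal.eq_top_iff_one _).mpr (Ideal.subset_span h1)]
    exact Submodule.mem_top
  | succ e ih =>
    intro q hq x hx
    push_cast at hq
    -- The extra factor `a` makes the claim stable under multiplication by scalars, which the
    -- projection to degree `q` alone does not respect.
    have key : ∀ z ∈ Ideal.span (selfGrading 𝒜 1 : Set A), ∀ a : A,
        intProj 𝒜 q (a * z) ∈ Ideal.span (selfGrading 𝒜 (e + 1 : ℕ) : Set A) := by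
      intro z hz
      induction hz using Submodule.span_induction with
      | zero => intro a; simp
      | add x y _ _ hx hy => intro a; rw [mul_add, map_add]; exact add_mem (hx a) (hy a)
      | smul c x _ hx => intro a; rw [smul_eq_mul, ← mul_assoc]; exact hx _
      | mem y hy =>
        intro a
        have h1 := (selfProj 𝒜).p_smul_of_mem hy q a
        have h2 : intProj 𝒜 q (a * y) = intProj 𝒜 (q - 1 * 1) a * y := h1
        rw [h2]
        have h3 := ih (q - 1 * 1) (by omega) _ (intProj_mem _ a)
        revert h3
        generalize intProj 𝒜 (q - 1 * 1) a = c
        intro h3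
        induction h3 using Submodule.span_induction with
        | zero => simp
        | add x y _ _ hx hy => rw [add_mul]; exact add_mem hx hy
        | smul c x _ hx => rw [smul_eq_mul, mul_assoc]; exact Ideal.mul_mem_left _ _ hx
        | mem t ht =>
          refine Ideal.subset_span ?_
          have ht' : t ∈ 𝒜 e := ht
          have hy' : y ∈ 𝒜 1 := hy
          exact SetLike.mul_mem_graded ht' hy'
    have := key x (hA q (by omega) x hx) 1
    rwa [one_mul, intProj_of_mem 𝒜 hx, if_pos rfl] at this

/-- `A_d` is the degree 1 part of `A^(d)`; coefficients from `A` outside `A^(d)` can be absorbed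
into the module element. -/
theorem smul_mem_irrelevant_smul {N : Type*} [AddCommGroup N] [Module A N] {c : A}
    (hc : c ∈ Ideal.span (selfGrading 𝒜 d : Set A)) (x : N) :
    c • x ∈ (HomogeneousIdeal.irrelevant (veroneseGrading 𝒜 d)).toIdeal •
      (⊤ : Submodule (veronese 𝒜 d) N) := by
  induction hc using Submodule.span_induction generalizing x with
  | zero => rw [zero_smul]; exact zero_mem _
  | add a b _ _ ha hb => rw [add_smul]; exact add_mem (ha x) (hb x)
  | smul a c _ hc => rw [smul_eq_mul, mul_comm, mul_smul]; exact hc _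
  | mem y hy =>
    obtain ⟨b, hb, rfl⟩ := exists_coe_eq_of_mem_selfGrading (𝒜 := 𝒜) (d := d) (j := 1)
      (by rwa [mul_one])
    exact Submodule.smul_mem_smul (mem_irrelevant_of_mem_selfGrading one_pos hb)
      (Submodule.mem_top (x := x))

/-- Generators have degree at most `r`, so in degree `q ≥ r + d` their coefficients have degree at
least `d` and lie in the ideal generated by `A_d`. -/
theorem veroneseTorVanish_zero
    (hA : ∀ q, 0 < q → ∀ x ∈ selfGrading 𝒜 q, x ∈ Ideal.span (selfGrading 𝒜 1 : Set A))
    {N : Type*} [AddCommGroup N] [Module A N] {𝒩 : ℤ → AddSubgroup N} (P : GradedProj 𝒜 1 𝒩)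
    {s r : ℤ} (hs : ∀ k < s, ∀ x ∈ 𝒩 k, x = 0) (hr : RegularityLE 𝒜 𝒩 r) {q : ℤ}
    (hq : r + d ≤ q) : VeroneseTorVanish 𝒜 d 𝒩 0 q := by
  refine torVanish_zero_of_le ((P.veronese d).reindex (by exact_mod_cast NeZero.ne d) q) ?_
  intro x hx
  rw [mul_zero, sub_zero] at hx
  have h1 := P.mem_span_of_regularityLE hs (fun q hq => hr 0 q (by simpa using hq)) q x hx
  have key : ∀ a : A, P.p q (a • x) ∈
      (HomogeneousIdeal.irrelevant (veroneseGrading 𝒜 d)).toIdeal •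
        (⊤ : Submodule (veronese 𝒜 d) N) := by
    clear hx
    induction h1 using Submodule.span_induction with
    | zero => intro a; rw [smul_zero, map_zero]; exact zero_mem _
    | add x y _ _ hx hy => intro a; rw [smul_add, map_add]; exact add_mem (hx a) (hy a)
    | smul c x _ hx => intro a; rw [← mul_smul]; exact hx _
    | mem y hy =>
      intro a
      obtain ⟨k, -, hk, hy⟩ := hy
      rw [P.p_smul_of_mem hy]
      exact smul_mem_irrelevant_smul (mem_span_selfGrading hA d _ (by omega) _ (intProj_mem _ a)) y
  have := key 1
  rwa [one_smul, P.p_self hx] at this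

variable (𝒜 d) in
/-- Over the Veronese subring, `Torₙ` of a graded `A`-module of regularity at most `r` vanishes in
the internal degrees at least `r + (n + 1) * d`. -/
def VeroneseBound (n : ℕ) : Prop :=
  ∀ (N : Type v) [AddCommGroup N] [Module A N] (𝒩 : ℤ → AddSubgroup N) (_ : GradedProj 𝒜 1 𝒩)
    (s r : ℤ), (∀ k < s, ∀ x ∈ 𝒩 k, x = 0) → RegularityLE 𝒜 𝒩 r →
    ∀ q : ℤ, r + (n + 1) * d ≤ q → VeroneseTorVanish 𝒜 d 𝒩 n q

/-- The inductive step for `A`, where `I` plays the role of the irrelevant ideal. -/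
theorem VeroneseBound.self_succ {I : Type u} [AddCommGroup I] [Module A I]
    {gr : ℤ → AddSubgroup I} (P : GradedProj 𝒜 1 gr) (φ : I →ₗ[A] A) (hφ : Function.Injective φ)
    (hmem : ∀ k, ∀ x ∈ gr k, φ x ∈ selfGrading 𝒜 k)
    (hsurj : ∀ k, k ≠ 0 → ∀ y ∈ selfGrading 𝒜 k, ∃ x ∈ gr k, φ x = y)
    (hs : ∀ k < 1, ∀ x ∈ gr k, x = 0) (hr : RegularityLE 𝒜 gr 1) {n : ℕ}
    (h : VeroneseBound.{u, u, w} 𝒜 d n) (q : ℤ) (hq : ((n + 1 : ℕ) + 1) * (d : ℤ) ≤ q) :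
    VeroneseTorVanish 𝒜 d (selfGrading 𝒜) (n + 1) q := by
  have hd : 0 < (d : ℤ) := by exact_mod_cast NeZero.pos d
  obtain ⟨X⟩ := FreePresentation.nonempty P hs fun q hq => hr 0 q (by simpa using hq)
  have key : ∀ (t : ℤ), (n : ℤ) + 2 ≤ t → ∀ m : ℕ, m < d →
      VeroneseTorVanish 𝒜 d (selfGrading 𝒜) (n + 1) (d * t + m) := by
    intro t ht m
    induction m with
    | zero =>
      intro _
      -- All degrees `dt - dk` are multiples of `d`, so the strand is that of `A^(d)` as a module
      -- over itself.
      refine TorVanish.of_injective (φ := (⟨⟨Subtype.val, fun _ _ => rfl⟩, fun _ _ => rfl⟩ :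
        veronese 𝒜 d →ₗ[veronese 𝒜 d] A)) Subtype.val_injective ?_ ?_
        (torVanish_self_succ (ℬ := veroneseGrading 𝒜 d) t n)
      · intro k x hx
        have h1 := coe_mem_selfGrading hx
        have h2 : (d : ℤ) * (t - 1 * k) = d * t + (0 : ℕ) - d * k := by push_cast; ring
        rwa [h2] at h1
      · intro k y hy
        refine exists_coe_eq_of_mem_selfGrading ?_
        convert hy using 2
        push_cast
        ring
    | succ m ih =>
      intro hm
      have h1 : VeroneseTorVanish 𝒜 d gr (n + 1) (d * t + (m + 1 : ℕ)) := by
        -- The generators have degree exactly 1, which lowers `m + 1` to `m`; the kernel has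
        -- regularity at most 2, and `2 + (n+1)d ≤ dt + m + 1` since `t ≥ n + 2` and `d ≥ 1`.
        refine X.veroneseTorVanish_succ (fun j hj hj' => ?_) (h X.Z X.grZ X.projZ 1 (1 + 1)
          (fun k hk x hx => X.grZ_eq_zero hk hx) (X.regularityLE_grZ hr) _ ?_)
        · obtain rfl : j = 1 := le_antisymm hj' hj
          have := ih (by omega)
          convert this using 1
          push_cast
          ring
        · push_cast
          nlinarith
      refine TorVanish.of_injective (φ := veroneseMap 𝒜 d φ) hφ (fun k => hmem _)
        (fun k => hsurj _ ?_) h1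
      -- Degree 0, where `I` and `A` may differ, would force `d ∣ m + 1`, contradicting `0 < m + 1 <
      -- d`.
      intro h0
      have h2 : (d : ℤ) ∣ (m + 1 : ℕ) := ⟨k - t, by linear_combination h0⟩
      have := Int.le_of_dvd (by positivity) h2
      omega
  have h1 := key (q / d) ((Int.le_ediv_iff_mul_le hd).mpr (by push_cast at hq; linarith))
    (q % d).toNat (by have := Int.emod_lt_of_pos q hd; have := Int.emod_nonneg q hd.ne'; omega)
  rwa [Int.toNat_of_nonneg (Int.emod_nonneg q hd.ne'), Int.mul_ediv_add_emod] at h1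

/-- The kernel of the presentation has regularity at most `r + 1`, and `r + 1 + (n+1)d ≤ r + (n+2)d`
because `d ≥ 1`. -/
theorem VeroneseBound.succ {n : ℕ}
    (hself : ∀ q : ℤ, ((n + 1 : ℕ) + 1) * (d : ℤ) ≤ q →
      VeroneseTorVanish 𝒜 d (selfGrading 𝒜) (n + 1) q)
    (h : VeroneseBound.{u, max u v, w} 𝒜 d n) : VeroneseBound.{u, v, w} 𝒜 d (n + 1) := by
  intro N _ _ 𝒩 P s r hs hr q hq
  have hd : 0 < (d : ℤ) := by exact_mod_cast NeZero.pos d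
  obtain ⟨X⟩ := FreePresentation.nonempty P hs fun q hq => hr 0 q (by simpa using hq)
  refine X.veroneseTorVanish_succ (fun j _ hj => hself _ (by linarith)) (h X.Z X.grZ X.projZ s
    (r + 1) (fun k hk x hx => X.grZ_eq_zero hk hx) (X.regularityLE_grZ hr) q ?_)
  push_cast at hq
  nlinarith

end Veronese

/-! ### From regularity to strands and back; the Koszul property; the final bound -/

section Regularity

variable {K : Type w} {A : Type u} [Field K] [CommRing A] [Algebra K A]
  {𝒜 : ℕ → Submodule K A} [GradedAlgebra 𝒜]

/-! ### Regularity and the vanishing of strands -/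

variable {M : Type v} [AddCommGroup M] [Module A M] {ℳ : ℤ → AddSubgroup M}

theorem reg_le_iff {r : ℤ} : reg 𝒜 ℳ ≤ ((r : WithTop ℤ) : WithBot (WithTop ℤ)) ↔
    ∀ (i : ℕ) (j : ℤ), residueTorGrading 𝒜 ℳ i j ≠ ⊥ → j ≤ r + i := by
  rw [reg, iSup_le_iff]
  refine forall_congr' fun i => ?_
  constructor
  · intro h j hj
    have h1 : ((j : WithTop ℤ) : WithBot (WithTop ℤ)) ≤ topDegree 𝒜 ℳ i :=
      le_iSup₂_of_le j hj le_rfl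
    have h2 := (add_le_add_left h1 _).trans h
    norm_cast at h2
    omega
  · intro h
    have h1 : topDegree 𝒜 ℳ i ≤ (((r + i : ℤ) : WithTop ℤ) : WithBot (WithTop ℤ)) :=
      iSup₂_le fun j hj => by exact_mod_cast h j hj
    refine (add_le_add_left h1 _).trans ?_
    norm_cast
    omega

open scoped Classical in
theorem mem_torCycles_iff {i : ℕ} {t : M ⊗[A] ((residueResolution 𝒜).ι i →₀ A)} :
    t ∈ torCycles 𝒜 M i ↔ TensorProduct.finsuppScalarRight A A M _ t ∈ coeffCycles 𝒜 M i := by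
  cases i with
  | zero => exact ⟨fun _ => Submodule.mem_top, fun _ => Submodule.mem_top⟩
  | succ i =>
    change (_ = _) ↔ (torDiff 𝒜 M i _ = 0)
    rw [coeffMap_finsuppScalarRight, LinearEquiv.map_eq_zero_iff]

open scoped Classical in
theorem mem_torBoundaries_iff {i : ℕ} {t : M ⊗[A] ((residueResolution 𝒜).ι i →₀ A)} :
    t ∈ torBoundaries 𝒜 M i ↔
      ∃ w, torDiff 𝒜 M i w = TensorProduct.finsuppScalarRight A A M _ t := by
  constructor
  · rintro ⟨s, rfl⟩
    exact ⟨_, coeffMap_finsuppScalarRight _ s⟩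
  · rintro ⟨w, hw⟩
    obtain ⟨s, rfl⟩ := (TensorProduct.finsuppScalarRight A A M _).surjective w
    rw [coeffMap_finsuppScalarRight] at hw
    exact ⟨s, (TensorProduct.finsuppScalarRight A A M _).injective hw⟩

open scoped Classical in
theorem symm_mem_tensorGrading {ι : Type u} {deg : ι → ℤ} {j : ℤ} {z : ι →₀ M}
    (hz : z ∈ strand (fun k => ℳ (j - 1 * k)) deg) :
    (TensorProduct.finsuppScalarRight A A M ι).symm z ∈ tensorGrading 𝒜 ℳ deg j := by
  rw [← Finsupp.sum_single z, map_finsuppSum]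
  refine sum_mem fun b _ => ?_
  beta_reduce
  rw [TensorProduct.finsuppScalarRight_symm_apply_single]
  refine AddSubgroup.subset_closure ⟨j - 1 * deg b, deg b, z b, Finsupp.single b 1, by ring, hz b,
    single_one_mem_freeGrading deg b, rfl⟩

open scoped Classical in
theorem apply_mem_of_mem_tensorGrading
    (hℳ : ∀ (i : ℕ) (k : ℤ) (a : A) (m : M), a ∈ 𝒜 i → m ∈ ℳ k → a • m ∈ ℳ (i + k))
    {ι : Type u} {deg : ι → ℤ} {j : ℤ} {t : M ⊗[A] (ι →₀ A)} (ht : t ∈ tensorGrading 𝒜 ℳ deg j)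
    (b : ι) : TensorProduct.finsuppScalarRight A A M ι t b ∈ ℳ (j - deg b) := by
  induction ht using AddSubgroup.closure_induction with
  | zero => simp
  | add x y _ _ hx hy => rw [map_add, Finsupp.add_apply]; exact add_mem hx hy
  | neg x _ hx => rw [map_neg, Finsupp.neg_apply]; exact neg_mem hx
  | mem x hx =>
    obtain ⟨p, q, m, f, rfl, hm, hf, rfl⟩ := hx
    rw [TensorProduct.finsuppScalarRight_apply_tmul_apply]
    have hb := hf b
    rcases h : q - deg b with n | n
    · rw [h] at hb
      have := hℳ n p (f b) m hb hm
      have e : (n : ℤ) + p = p + q - deg b := by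
        have : q - deg b = (n : ℤ) := h
        omega
      rwa [e] at this
    · rw [h] at hb
      have h0 : f b = 0 := hb
      rw [h0, zero_smul]
      exact zero_mem _

theorem torVanish_of_residueTorGrading_eq_bot (P : GradedProj 𝒜 1 ℳ) {i : ℕ} {j : ℤ}
    (h : residueTorGrading 𝒜 ℳ i j = ⊥) : TorVanish 𝒜 (fun k => ℳ (j - 1 * k)) i := by
  classical
  intro z hz hc
  refine (P.reindex one_ne_zero j).exists_strand_preimage ((residueResolution 𝒜).d_mem i) hz ?_
  have hc' : (TensorProduct.finsuppScalarRight A A M _).symm z ∈ torCycles 𝒜 M i := by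
    rw [mem_torCycles_iff, LinearEquiv.apply_symm_apply]
    exact hc
  have h1 : ((torBoundaries 𝒜 M i).submoduleOf (torCycles 𝒜 M i)).mkQ ⟨_, hc'⟩ ∈
      residueTorGrading 𝒜 ℳ i j :=
    ⟨⟨_, hc'⟩, symm_mem_tensorGrading hz, rfl⟩
  rw [h, AddSubgroup.mem_bot, Submodule.mkQ_apply, Submodule.Quotient.mk_eq_zero] at h1
  have h2 : (TensorProduct.finsuppScalarRight A A M _).symm z ∈ torBoundaries 𝒜 M i := h1
  rw [mem_torBoundaries_iff, LinearEquiv.apply_symm_apply] at h2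
  exact h2

/-- A class dies as soon as it is any boundary, so `w` need not be homogeneous. Only compatibility
with scalars is asked of `ℳ`, which suits the coarse Veronese grading. -/
theorem residueTorGrading_eq_bot
    (hℳ : ∀ (i : ℕ) (k : ℤ) (a : A) (m : M), a ∈ 𝒜 i → m ∈ ℳ k → a • m ∈ ℳ (i + k))
    {i : ℕ} {j : ℤ}
    (h : ∀ z ∈ coeffCycles 𝒜 M i, (∀ b, z b ∈ ℳ (j - (residueResolution 𝒜).deg i b)) →
      ∃ w, torDiff 𝒜 M i w = z) : residueTorGrading 𝒜 ℳ i j = ⊥ := by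
  classical
  rw [eq_bot_iff]
  rintro _ ⟨t, ht, rfl⟩
  rw [AddSubgroup.mem_bot]
  refine (Submodule.Quotient.mk_eq_zero _).mpr ?_
  change (t : M ⊗[A] _) ∈ torBoundaries 𝒜 M i
  rw [mem_torBoundaries_iff]
  exact h _ (mem_torCycles_iff.mp t.2) (apply_mem_of_mem_tensorGrading hℳ ht)

theorem regularityLE_of_reg_le (P : GradedProj 𝒜 1 ℳ) {r : ℤ}
    (h : reg 𝒜 ℳ ≤ ((r : WithTop ℤ) : WithBot (WithTop ℤ))) : RegularityLE 𝒜 ℳ r := by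
  intro n q hq
  apply torVanish_of_residueTorGrading_eq_bot P
  by_contra h0
  have := reg_le_iff.mp h n q h0
  omega

/-! ### The irrelevant ideal -/

theorem intProj_zero_of_mem_irrelevant {x : A} (hx : x ∈ (HomogeneousIdeal.irrelevant 𝒜).toIdeal) :
    intProj 𝒜 0 x = 0 :=
  (HomogeneousIdeal.mem_irrelevant_iff 𝒜 x).mp hx

variable (𝒜) in
/-- The grading of the irrelevant ideal. -/
def irrelevantGrading (k : ℤ) : AddSubgroup (HomogeneousIdeal.irrelevant 𝒜).toIdeal :=
  (selfGrading 𝒜 k).comap (HomogeneousIdeal.irrelevant 𝒜).toIdeal.subtype.toAddMonoidHom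

variable (𝒜) in
/-- The projections of the irrelevant ideal on its graded pieces. -/
def irrelevantProj : GradedProj 𝒜 1 (irrelevantGrading 𝒜) :=
  (selfProj 𝒜).restrict (HomogeneousIdeal.irrelevant 𝒜).toIdeal fun k x hx => by
    rcases lt_trichotomy k 0 with hk | rfl | hk
    · rw [selfGrading_eq_zero hk ((selfProj 𝒜).mem k x)]
      exact zero_mem _
    · rw [show (selfProj 𝒜).p 0 x = 0 from intProj_zero_of_mem_irrelevant hx]
      exact zero_mem _
    · exact mem_irrelevant_of_mem_selfGrading hk ((selfProj 𝒜).mem k x)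

theorem irrelevantGrading_eq_zero {k : ℤ} (hk : k < 1)
    {x : (HomogeneousIdeal.irrelevant 𝒜).toIdeal} (hx : x ∈ irrelevantGrading 𝒜 k) : x = 0 := by
  apply Subtype.ext
  rcases (Int.lt_add_one_iff.mp hk : k ≤ 0).lt_or_eq with hk | rfl
  · exact selfGrading_eq_zero hk hx
  · refine ((selfProj 𝒜).p_self hx).symm.trans ?_
    exact intProj_zero_of_mem_irrelevant x.2

theorem strandExact_irrelevant :
    StrandExact (selfGrading 𝒜) (irrelevantGrading 𝒜) (residueGrading 𝒜)
      (HomogeneousIdeal.irrelevant 𝒜).toIdeal.subtype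
      (HomogeneousIdeal.irrelevant 𝒜).toIdeal.mkQ where
  injective := Subtype.val_injective
  comp x := (Submodule.Quotient.mk_eq_zero _).mpr x.2
  map_left k x hx := hx
  map_right k x hx := by
    rcases lt_trichotomy k 0 with hk | rfl | hk
    · rw [selfGrading_eq_zero hk hx, map_zero]
      exact zero_mem _
    · simp [residueGrading]
    · rw [Submodule.mkQ_apply,
        (Submodule.Quotient.mk_eq_zero _).mpr (mem_irrelevant_of_mem_selfGrading hk hx)]
      exact zero_mem _
  exact k x hx h0 := ⟨⟨x, (Submodule.Quotient.mk_eq_zero _).mp h0⟩, hx, rfl⟩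
  surjective k y hy := by
    by_cases hk : k = 0
    · subst hk
      obtain ⟨a, rfl⟩ := Submodule.mkQ_surjective _ y
      refine ⟨intProj 𝒜 0 a, intProj_mem 0 a, ?_⟩
      rw [← sub_eq_zero, ← map_sub]
      refine (Submodule.Quotient.mk_eq_zero _).mpr ?_
      change _ ∈ HomogeneousIdeal.irrelevant 𝒜
      rw [HomogeneousIdeal.mem_irrelevant_iff]
      change intProj 𝒜 0 _ = 0
      rw [map_sub, intProj_of_mem 𝒜 (intProj_mem 0 a), if_pos rfl, sub_self]
    · rw [residueGrading, if_neg hk] at hy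
      exact ⟨0, zero_mem _, by rw [(AddSubgroup.mem_bot).mp hy, map_zero]⟩

/-- Shift along `0 → A₊ → A → K → 0`: in degrees above `n + 1` both `Tor_{n+1}(K)` and `Tor_n(A)`
vanish. -/
theorem IsKoszul.regularityLE_irrelevant (h : IsKoszul 𝒜) :
    RegularityLE 𝒜 (irrelevantGrading 𝒜) 1 := by
  have h0 := regularityLE_of_reg_le (residueGrading_isGradedModule 𝒜).gradedProj (r := 0)
    (le_of_eq h)
  intro n q hq
  refine (strandExact_irrelevant.reindex fun k => q - 1 * k).torVanish_left
    ((selfProj 𝒜).reindex one_ne_zero q).lowersDegree ?_ (h0 (n + 1) q (by push_cast; omega))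
  cases n with
  | zero => exact torVanish_self_zero (by push_cast at hq; omega)
  | succ n => exact torVanish_self_succ q n

/-- `A₊` starts in degree 1 and has regularity at most 1, so Nakayama generates it by `A_1`. -/
theorem IsKoszul.mem_span_selfGrading_one (h : IsKoszul 𝒜) (q : ℤ) (hq : 0 < q) (x : A)
    (hx : x ∈ selfGrading 𝒜 q) : x ∈ Ideal.span (selfGrading 𝒜 1 : Set A) := by
  have h1 := (irrelevantProj 𝒜).mem_span_of_regularityLE
    (fun k hk x hx => irrelevantGrading_eq_zero hk hx)
    (fun q hq => h.regularityLE_irrelevant 0 q (by simpa using hq)) q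
    ⟨x, mem_irrelevant_of_mem_selfGrading hq hx⟩ hx
  have h2 := Submodule.mem_map_of_mem
    (f := (HomogeneousIdeal.irrelevant 𝒜).toIdeal.subtype) h1
  rw [Submodule.map_span] at h2
  refine Submodule.span_mono ?_ h2
  rintro _ ⟨y, ⟨k, h1, h2, hy⟩, rfl⟩
  obtain rfl : k = 1 := le_antisymm h2 h1
  exact hy

/-! ### The bound over the Veronese subring -/

section Bound

variable {d : ℕ} [NeZero d]

theorem IsKoszul.veroneseBound_zero (h : IsKoszul 𝒜) : VeroneseBound.{u, v, w} 𝒜 d 0 :=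
  fun _ _ _ _ P _ _ hs hr _ hq =>
    veroneseTorVanish_zero h.mem_span_selfGrading_one P hs hr (by simpa using hq)

theorem IsKoszul.veroneseTorVanish_self (h : IsKoszul 𝒜) {n : ℕ}
    (hn : VeroneseBound.{u, u, w} 𝒜 d n) (q : ℤ) (hq : ((n + 1 : ℕ) + 1) * (d : ℤ) ≤ q) :
    VeroneseTorVanish 𝒜 d (selfGrading 𝒜) (n + 1) q :=
  VeroneseBound.self_succ (irrelevantProj 𝒜) (HomogeneousIdeal.irrelevant 𝒜).toIdeal.subtype
    Subtype.val_injective (fun _ _ hx => hx)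
    (fun k hk y hy => by
      rcases hk.lt_or_gt with hk | hk
      · exact ⟨0, zero_mem _, by rw [selfGrading_eq_zero hk hy, map_zero]⟩
      · exact ⟨⟨y, mem_irrelevant_of_mem_selfGrading hk hy⟩, hy, rfl⟩)
    (fun _ hk _ hx => irrelevantGrading_eq_zero hk hx) h.regularityLE_irrelevant hn q hq

/-- Kernels of presentations live in the universe `max u v`. The bound is therefore proved for `u`
and for `max u v`, where the induction closes up, and then descends to `v`. -/
theorem IsKoszul.veroneseBound_ring (h : IsKoszul 𝒜) (n : ℕ) : VeroneseBound.{u, u, w} 𝒜 d n := by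
  induction n with
  | zero => exact h.veroneseBound_zero
  | succ n ih => exact VeroneseBound.succ.{u, u, w} (h.veroneseTorVanish_self ih) ih

theorem IsKoszul.veroneseBound_max (h : IsKoszul 𝒜) (n : ℕ) :
    VeroneseBound.{u, max u v, w} 𝒜 d n := by
  induction n with
  | zero => exact h.veroneseBound_zero
  | succ n ih =>
    exact VeroneseBound.succ.{u, max u v, w} (h.veroneseTorVanish_self (h.veroneseBound_ring n)) ih

theorem IsKoszul.veroneseBound (h : IsKoszul 𝒜) (n : ℕ) : VeroneseBound.{u, v, w} 𝒜 d n := by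
  cases n with
  | zero => exact h.veroneseBound_zero
  | succ n =>
    exact VeroneseBound.succ (h.veroneseTorVanish_self (h.veroneseBound_ring n))
      (h.veroneseBound_max.{u, v, w} n)

theorem veroneseModuleGrading_smul_mem (P : GradedProj 𝒜 1 ℳ) (i : ℕ) (k : ℤ)
    (a : veronese 𝒜 d) (m : M) (ha : a ∈ veroneseGrading 𝒜 d i)
    (hm : m ∈ veroneseModuleGrading ℳ d k) : a • m ∈ veroneseModuleGrading ℳ d (i + k) := by
  induction hm using AddSubgroup.iSup_induction' with
  | h1 => rw [smul_zero]; exact zero_mem _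
  | hadd x y _ _ hx hy => rw [smul_add]; exact add_mem hx hy
  | hp c x hx =>
    refine AddSubgroup.mem_iSup_of_mem c ?_
    have := (P.veronese d).smul_mem ha hx
    convert this using 2
    ring

theorem sum_p_of_mem_veroneseModuleGrading (P : GradedProj 𝒜 1 ℳ) {k : ℤ} {x : M}
    (hx : x ∈ veroneseModuleGrading ℳ d k) : ∑ c : Fin d, P.p (k * d + (c : ℕ)) x = x := by
  induction hx using AddSubgroup.iSup_induction' with
  | h1 => simp
  | hadd x y _ _ hx hy => simp only [map_add, Finset.sum_add_distrib, hx, hy]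
  | hp c x hx =>
    rw [Finset.sum_eq_single c]
    · exact P.p_self hx
    · intro c' _ hc
      rw [P.of_mem hx, if_neg]
      intro h
      apply hc
      ext
      omega
    · simp

/-- The projection to a strand commutes with the differentials, so it turns an arbitrary cycle into
a cycle of the strand. -/
theorem TorVanish.exists_torDiff_eq_strandMap {𝒢 : ℤ → AddSubgroup M} (P : GradedProj 𝒜 (-1) 𝒢)
    {n : ℕ} (h : TorVanish 𝒜 𝒢 n) {z : (residueResolution 𝒜).ι n →₀ M}
    (hz : z ∈ coeffCycles 𝒜 M n) :
    ∃ w, torDiff 𝒜 M n w = P.strandMap ((residueResolution 𝒜).deg n) z := by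
  have h1 : P.strandMap ((residueResolution 𝒜).deg n) z ∈ coeffCycles 𝒜 M n := by
    cases n with
    | zero => exact Submodule.mem_top
    | succ n =>
      have hz' : torDiff 𝒜 M n z = 0 := hz
      change torDiff 𝒜 M n _ = 0
      rw [torDiff, ← P.strandMap_coeffMap ((residueResolution 𝒜).d_mem n), ← torDiff, hz',
        map_zero]
  obtain ⟨w, _, hw⟩ := h _ (P.strandMap_mem _ z) h1
  exact ⟨w, hw⟩

theorem add_mul_le_of_ceil_add_lt {r j : ℤ} {n : ℕ} (h : ⌈(r : ℚ) / d⌉ + n < j) :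
    r + ((n : ℤ) + 1) * d ≤ j * d := by
  have hd : (0 : ℚ) < d := by exact_mod_cast NeZero.pos d
  have h1 := Int.le_ceil ((r : ℚ) / d)
  have h2 : (⌈(r : ℚ) / d⌉ : ℚ) + n + 1 ≤ j := by exact_mod_cast h
  have h3 : (r : ℚ) / d ≤ j - n - 1 := by linarith
  rw [div_le_iff₀ hd] at h3
  have h4 : (r : ℚ) + (n + 1) * d ≤ j * d := by linarith
  exact_mod_cast h4

/-- A cycle of Veronese degree `j` is the sum of its projections to the `A`-degrees `jd + c`, `0 ≤ c
< d`. Each of these is at least `r + (n+1)d`, so each projection is a boundary. -/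
theorem residueTorGrading_veronese_eq_bot (hK : IsKoszul 𝒜) (P : GradedProj 𝒜 1 ℳ) {s r : ℤ}
    (hs : ∀ k < s, ∀ x ∈ ℳ k, x = 0) (hr : RegularityLE 𝒜 ℳ r) {n : ℕ} {j : ℤ}
    (hj : r + ((n : ℤ) + 1) * d ≤ j * d) :
    residueTorGrading (veroneseGrading 𝒜 d) (veroneseModuleGrading ℳ d) n j = ⊥ := by
  have hsmul := veroneseModuleGrading_smul_mem (d := d) P
  refine residueTorGrading_eq_bot (𝒜 := veroneseGrading 𝒜 d) (ℳ := veroneseModuleGrading ℳ d) hsmul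
    fun z hz hzb => ?_
  have hne : (d : ℤ) ≠ 0 := by exact_mod_cast NeZero.ne d
  let Q : ∀ c : Fin d, GradedProj (veroneseGrading 𝒜 d) (-1)
      (fun k => ℳ (j * d + (c : ℕ) - d * k)) := fun c => (P.veronese d).reindex hne _
  choose w hw using fun c : Fin d => TorVanish.exists_torDiff_eq_strandMap (Q c)
    (hK.veroneseBound n M ℳ P s r hs hr (j * d + (c : ℕ)) (by omega)) hz
  refine ⟨∑ c, w c, ?_⟩
  rw [map_sum]
  simp only [hw]
  ext b
  rw [Finsupp.finsetSum_apply]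
  refine Eq.trans (Finset.sum_congr rfl fun c _ => ?_)
    (sum_p_of_mem_veroneseModuleGrading P (hzb b))
  rw [GradedProj.strandMap_apply]
  change P.p (j * d + (c : ℕ) - d * _) _ = _
  congr 2
  ring

theorem reg_veronese_le (hK : IsKoszul 𝒜) (P : GradedProj 𝒜 1 ℳ) {s r : ℤ}
    (hs : ∀ k < s, ∀ x ∈ ℳ k, x = 0)
    (hr : reg 𝒜 ℳ ≤ ((r : WithTop ℤ) : WithBot (WithTop ℤ))) :
    reg (veroneseGrading 𝒜 d) (veroneseModuleGrading ℳ d) ≤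
      (((⌈(r : ℚ) / d⌉ : ℤ) : WithTop ℤ) : WithBot (WithTop ℤ)) := by
  refine reg_le_iff.mpr fun n j hj => ?_
  refine not_lt.mp fun hlt => hj ?_
  exact residueTorGrading_veronese_eq_bot hK P hs (regularityLE_of_reg_le P hr)
    (add_mul_le_of_ceil_add_lt hlt)

end Bound

/-! ### Finitely generated graded modules are bounded below -/

/-- Each of the finitely many generators has a lowest degree, and `A` has no negative degrees. -/
theorem IsGradedModule.exists_lower_bound [Module.Finite A M] (h : IsGradedModule 𝒜 ℳ) :
    ∃ s : ℤ, ∀ k < s, ∀ x ∈ ℳ k, x = 0 := by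
  classical
  have h1 : ∀ x : M, ∃ s : ℤ, ∀ k < s, h.gradedProj.p k x = 0 := by
    intro x
    let := h.isInternal.chooseDecomposition
    induction x using DirectSum.Decomposition.inductionOn ℳ with
    | zero => exact ⟨0, by simp⟩
    | add x y hx hy =>
      obtain ⟨s, hs⟩ := hx
      obtain ⟨t, ht⟩ := hy
      refine ⟨min s t, fun k hk => ?_⟩
      rw [map_add, hs k (hk.trans_le (min_le_left _ _)), ht k (hk.trans_le (min_le_right _ _)),
        add_zero]
    | @homogeneous j x =>
      exact ⟨j, fun k hk => by rw [h.gradedProj.of_mem x.2, if_neg hk.ne']⟩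
  choose f hf using h1
  obtain ⟨S, hS⟩ := Module.Finite.fg_top (R := A) (M := M)
  obtain ⟨s, hs⟩ := (S.image f).bddBelow
  have key : ∀ x : M, ∀ k < s, h.gradedProj.p k x = 0 := by
    intro x
    have hx : x ∈ Submodule.span A (S : Set M) := hS ▸ Submodule.mem_top
    induction hx using Submodule.span_induction with
    | zero => simp
    | add x y _ _ hx hy => intro k hk; rw [map_add, hx k hk, hy k hk, add_zero]
    | mem x hx => exact fun k hk => hf x k (hk.trans_le (hs (Finset.mem_coe.mpr (Finset.mem_image_of_mem f hx))))
    | smul a x _ hx =>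
      intro k hk
      rw [← DirectSum.sum_support_decompose 𝒜 a, Finset.sum_smul, map_sum]
      refine Finset.sum_eq_zero fun i _ => ?_
      rw [h.gradedProj.smul i _ (DirectSum.decompose 𝒜 a i).2, hx _ (by omega), smul_zero]
  exact ⟨s, fun k hk x hx => by rw [← h.gradedProj.p_self hx, key x k hk]⟩

theorem reg_veronese_le_ceilDiv [Module.Finite A M] (hK : IsKoszul 𝒜) (hM : IsGradedModule 𝒜 ℳ)
    (d : ℕ) [NeZero d] :
    reg (veroneseGrading 𝒜 d) (veroneseModuleGrading ℳ d) ≤ ceilDiv (reg 𝒜 ℳ) d := by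
  obtain ⟨s, hs⟩ := hM.exists_lower_bound
  have key := fun r => reg_veronese_le (d := d) (r := r) hK hM.gradedProj hs
  have hd : (d : ℚ) ≠ 0 := by exact_mod_cast NeZero.ne d
  revert key
  generalize reg 𝒜 ℳ = R
  generalize reg (veroneseGrading 𝒜 d) (veroneseModuleGrading ℳ d) = R'
  intro key
  induction R with
  | bot =>
    -- Regularity `-∞` is below every integer; the choice `r = zd` bounds `R'` by an arbitrary `z`,
    -- so `R'` is `-∞` as well.
    have h1 : ∀ z : ℤ, R' ≤ ((z : WithTop ℤ) : WithBot (WithTop ℤ)) := by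
      intro z
      have := key (z * d) bot_le
      push_cast at this
      rwa [mul_div_cancel_right₀ _ hd, Int.ceil_intCast] at this
    induction R' with
    | bot => exact bot_le
    | coe y =>
      exfalso
      induction y with
      | top =>
        have := h1 0
        rw [WithBot.coe_le_coe, top_le_iff] at this
        exact WithTop.coe_ne_top this
      | coe y =>
        have := h1 (y - 1)
        norm_cast at this
        omega
  | coe y =>
    induction y with
    | top => exact le_top
    | coe y => exact key y le_rfl

theorem ceilDiv_le_one {R : WithBot (WithTop ℤ)} {d : ℕ} [NeZero d]
    (h : R ≤ (((d : ℤ) : WithTop ℤ) : WithBot (WithTop ℤ))) : ceilDiv R d ≤ 1 := by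
  have hd : (0 : ℚ) < d := by exact_mod_cast NeZero.pos d
  induction R with
  | bot => exact bot_le
  | coe y =>
    induction y with
    | top => simp at h
    | coe y =>
      have h1 : y ≤ d := by exact_mod_cast h
      have h2 : ⌈(y : ℚ) / (d : ℚ)⌉ ≤ 1 := by
        rw [Int.ceil_le, div_le_iff₀ hd]
        have : (y : ℚ) ≤ d := by exact_mod_cast h1
        simpa using this
      change (((⌈(y : ℚ) / (d : ℚ)⌉ : ℤ) : WithTop ℤ) : WithBot (WithTop ℤ)) ≤ 1
      exact_mod_cast h2

end Regularity

end GradedReg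

theorem mainTheorem9 {K : Type*} {A : Type*} [Field K] [CommRing A] [Algebra K A]
    (𝒜 : ℕ → Submodule K A) [GradedAlgebra 𝒜]
    (hA : GradedReg.IsStandardGraded 𝒜) (hK : GradedReg.IsKoszul 𝒜)
    {M : Type*} [AddCommGroup M] [Module A M] [Module.Finite A M]
    (ℳ : ℤ → AddSubgroup M) (hM : GradedReg.IsGradedModule 𝒜 ℳ)
    (d : ℕ) [NeZero d] :
    GradedReg.reg (GradedReg.veroneseGrading 𝒜 d) (GradedReg.veroneseModuleGrading ℳ d) ≤
        GradedReg.ceilDiv (GradedReg.reg 𝒜 ℳ) d ∧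
      (GradedReg.reg 𝒜 ℳ ≤ (((d : ℤ) : WithTop ℤ) : WithBot (WithTop ℤ)) →
        GradedReg.reg (GradedReg.veroneseGrading 𝒜 d) (GradedReg.veroneseModuleGrading ℳ d) ≤
          1) := by
  have h := GradedReg.reg_veronese_le_ceilDiv hK hM d
  exact ⟨h, fun hr => h.trans (GradedReg.ceilDiv_le_one hr)⟩
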